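/- Let $m\ge 1$, and for $j=1,\dots,m$ let $\kappa_j>0$ and let $\varphi_j\in C^\infty[-1,1]$ be real-valued. Put $|\kappa|=\sum_{j=1}^m\kappa_j$, and let $\alpha,\beta\in\mathbb{R}$ satisfy $\alpha\ge\beta$ and $\alpha\ge|\kappa|-\tfrac12$. Let $P_n^{(\alpha,\beta)}$ be the Jacobi polynomial of degree index $n$ in the usual normalization, $$P_n^{(\alpha,\beta)}(y)=\frac1{n!}\sum_{k=0}^n\binom nk\,(n+\alpha+\beta+1)_k\,(\alpha+k+1)_{n-k}\Bigl(\frac{y-1}2\Bigr)^k,\qquad (b)_k=b(b+1)\cdots(b+k-1).$$ Then there is a constant $c>0$, depending only on $m$, $\alpha$, $\beta$, the $\kappa_j$ and the $\varphi_j$, such that for all integers $n\ge1$, all real $a_1,\dots,a_m$ with $a_j\ne0$ and $|a|:=\sum_{j=1}^m|a_j|\le1$, and all $x\in\mathbb{R}$ with $|x|+|a|\le1$, the integral below converges absolutely and $$\left|\int_{[-1,1]^m}P_n^{(\alpha,\beta)}\Bigl(\sum_{j=1}^m a_jt_j+x\Bigr)\prod_{j=1}^m\varphi_j(t_j)(1-t_j^2)^{\kappa_j-1}\,dt\right|\le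 c\,n^{\alpha-2|\kappa|}\,\frac{\prod_{j=1}^m\bigl(|a_j|+n^{-1}\sqrt{1-|a|-|x|}+n^{-2}\bigr)^{-\kappa_j}}{\bigl(1+n\sqrt{1-|a|-|x|}\bigr)^{\alpha+\frac12-|\kappa|}}.$$ -/

import Mathlib

open scoped ContDiff

/-- The Jacobi polynomial `P_n^{(α,β)}` with the usual (Szegő) normalization
`P_n^{(α,β)}(1) = (α+1)_n / n!`, for arbitrary real parameters:
`(1 / n!) ∑_{k=0}^n binom(n,k) (n+α+β+1)_k (α+k+1)_{n-k} ((x - 1) / 2)^k`,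
where `(a)_k = a (a+1) ⋯ (a+k-1)`.  For `α, β > -1` this is the degree `n` orthogonal polynomial
for the weight `(1-t)^α (1+t)^β` on `[-1,1]`. -/
noncomputable def jacobiPoly (n : ℕ) (α β : ℝ) : Polynomial ℝ :=
  ∑ k ∈ Finset.range (n + 1),
    Polynomial.C
        ((n.choose k : ℝ) * (ascPochhammer ℝ k).eval ((n : ℝ) + α + β + 1)
          * (ascPochhammer ℝ (n - k)).eval (α + (k : ℝ) + 1) / (n.factorial : ℝ))
      * (Polynomial.C (1 / 2 : ℝ) * (Polynomial.X - 1)) ^ k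

/-- The integrand `P_n^{(α,β)}(∑ a_j t_j + x) ∏ φ_j(t_j) (1 - t_j²)^{κ_j - 1}`. -/
noncomputable def jacobiIntegrand {m : ℕ} (n : ℕ) (α β : ℝ) (κ : Fin m → ℝ) (φ : Fin m → ℝ → ℝ)
    (a : Fin m → ℝ) (x : ℝ) (t : Fin m → ℝ) : ℝ :=
  (jacobiPoly n α β).eval ((∑ j, a j * t j) + x)
    * ∏ j, (φ j (t j) * (1 - t j ^ 2) ^ (κ j - 1))

/-!
For `y ∈ [-1, 1]` put `D(y) = ε √(1 - |y|) + ε²` with `ε = 1 / n`. This is the length on which `P_n`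
oscillates near `y`, and Szegő's bound reads `|P_n y| ≲ n ^ (-α - 1) D(y) ^ (-α - 1 / 2)` for `β ≤ α`
(`exists_jacobiPoly_bound`). With `D` taken at distance `1 - |a| - |x|` from the endpoints, the
right-hand side of the theorem is a multiple of
`n ^ (-α - 1) D ^ (-α - 1 / 2) ∏ j, (D / (|a j| + D)) ^ κ j`
(`bound_eq_profile_mul_prod`): in each variable only the part of the weight within distance
`D / |a j|` of the endpoints `±1` should contribute, and the theorem says that it does.

The reason is cancellation. A primitive of `P_n^{(α,β)}` is `2 / (n + α + β)` times
`P_{n+1}^{(α-1,β-1)}`, so Szegő's bound for all real parameters shows that each integration gains a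
factor `D(y)` (`exists_jacobi_chain`). Near the endpoint `t = 1` of one variable, with `s = 1 - t`, the
point `y - a s` has scale at most `D(y) + √(D(y) |a| s)`. An integration by parts costs `1 / (|a| s)`,
one factor `|a|⁻¹` from the chain and one factor `s⁻¹` from the derivative of the weight `s ^ (κ - 1)`.
For `s ≥ D(y) / |a|` it therefore gains `√(D(y) / (|a| s))`, and sufficiently many of them leave a
contribution of order `(D(y) / |a|) ^ κ` (`IsEndpointWeight.exists_abs_integral_le`).

Averaging a chain of primitives in one variable gives a chain of primitives with the same kind of
bound, so the variables can be treated one after the other (`exists_average_chain`,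
`exists_abs_integral_pi_le`). Each variable is split into its two endpoint parts; a choice of endpoints
in all variables gives a corner `x + ∑ j, ± a j`, whose scale is at least `D`. The condition
`|κ| ≤ α + 1 / 2` enters only here: it makes the bounds at the corners decreasing functions of the
scale.

Szegő's bound itself is obtained from the differential equation. In Liouville normal form in the
angular variable the energy changes by a bounded factor on `[1 / n, π / 4]` (`exists_jacobiEnergy_le`);
at `1 / n` it is estimated from the explicit coefficients (`exists_jacobiSeries_bound_near_zero`), and
the other half of `[-1, 1]` follows by reflection (`jacobiPoly_eval_neg`).
-/

/-! ### Jacobi polynomials: coefficients, differential equation, reflection -/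

/-- The coefficient of `((x - 1) / 2) ^ k` in `jacobiPoly n α β`. -/
noncomputable def jacobiCoeff (n : ℕ) (α β : ℝ) (k : ℕ) : ℝ :=
  (n.choose k : ℝ) * (ascPochhammer ℝ k).eval ((n : ℝ) + α + β + 1)
    * (ascPochhammer ℝ (n - k)).eval (α + (k : ℝ) + 1) / (n.factorial : ℝ)

/-- The Jacobi polynomial in the variable `v = (x - 1) / 2`, so that `x = 1` is `v = 0` and
`x = -1` is `v = -1`. -/
noncomputable def jacobiSeries (n : ℕ) (α β : ℝ) : Polynomial ℝ :=
  ∑ k ∈ Finset.range (n + 1), Polynomial.monomial k (jacobiCoeff n α β k)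

lemma jacobiPoly_eval (n : ℕ) (α β x : ℝ) :
    (jacobiPoly n α β).eval x = (jacobiSeries n α β).eval ((x - 1) / 2) := by
  simp only [jacobiPoly, jacobiSeries, Polynomial.eval_finsetSum, Polynomial.eval_mul,
    Polynomial.eval_C, Polynomial.eval_pow, Polynomial.eval_sub, Polynomial.eval_X,
    Polynomial.eval_one, Polynomial.eval_monomial, jacobiCoeff]
  refine Finset.sum_congr rfl fun k _ => ?_
  rw [show (1 / 2 : ℝ) * (x - 1) = (x - 1) / 2 by ring]

lemma jacobiCoeff_of_lt {n k : ℕ} (h : n < k) (α β : ℝ) : jacobiCoeff n α β k = 0 := by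
  simp [jacobiCoeff, Nat.choose_eq_zero_of_lt h]

lemma jacobiSeries_coeff (n : ℕ) (α β : ℝ) (k : ℕ) :
    (jacobiSeries n α β).coeff k = jacobiCoeff n α β k := by
  simp only [jacobiSeries, Polynomial.finsetSum_coeff, Polynomial.coeff_monomial]
  rw [Finset.sum_ite_eq']
  split_ifs with h
  · rfl
  · rw [jacobiCoeff_of_lt (by simpa using h)]

lemma ascPochhammer_eval_succ_left (k : ℕ) (r : ℝ) :
    (ascPochhammer ℝ (k + 1)).eval r = r * (ascPochhammer ℝ k).eval (r + 1) := by
  simp [ascPochhammer_succ_left]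

lemma jacobiCoeff_succ_succ (n : ℕ) (α β : ℝ) (k : ℕ) :
    jacobiCoeff (n + 1) α β (k + 1) * (k + 1)
      = (n + α + β + 2) * jacobiCoeff n (α + 1) (β + 1) k := by
  have h := Nat.add_one_mul_choose_eq n k
  have h' : ((n + 1 : ℕ) : ℝ) * (n.choose k : ℝ) = ((n + 1).choose (k + 1) : ℝ) * (k + 1 : ℕ) := by
    exact_mod_cast h
  simp only [jacobiCoeff, ascPochhammer_eval_succ_left, Nat.add_sub_add_right,
    Nat.factorial_succ, Nat.cast_mul]
  have e1 : ((n + 1 : ℕ) : ℝ) + α + β + 1 = n + α + β + 2 := by push_cast; ring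
  have e2 : (n : ℝ) + α + β + 2 + 1 = n + (α + 1) + (β + 1) + 1 := by ring
  have e3 : α + ((k + 1 : ℕ) : ℝ) + 1 = α + 1 + k + 1 := by push_cast; ring
  rw [e1, e2, e3]
  have hf : (n.factorial : ℝ) ≠ 0 := by positivity
  have hn : ((n + 1 : ℕ) : ℝ) ≠ 0 := by positivity
  field_simp
  push_cast at h' ⊢
  linear_combination (-(n + α + β + 2) *
    (ascPochhammer ℝ k).eval (n + (α + 1) + (β + 1) + 1) *
    (ascPochhammer ℝ (n - k)).eval (α + 1 + k + 1)) * h'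

lemma derivative_jacobiSeries_succ (n : ℕ) (α β : ℝ) :
    Polynomial.derivative (jacobiSeries (n + 1) α β)
      = Polynomial.C (n + α + β + 2) * jacobiSeries n (α + 1) (β + 1) := by
  ext k
  rw [Polynomial.coeff_derivative, Polynomial.coeff_C_mul, jacobiSeries_coeff, jacobiSeries_coeff,
    jacobiCoeff_succ_succ]

/-- The hypergeometric recurrence of the coefficients, equivalent to the differential equation. -/
lemma jacobiCoeff_rec (n : ℕ) (α β : ℝ) (k : ℕ) :
    ((n : ℝ) - k) * (n + k + α + β + 1) * jacobiCoeff n α β k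
      = (k + 1) * (k + 1 + α) * jacobiCoeff n α β (k + 1) := by
  rcases lt_trichotomy n k with h | h | h
  · rw [jacobiCoeff_of_lt h, jacobiCoeff_of_lt (h.trans (Nat.lt_succ_self k))]; simp
  · subst h; rw [jacobiCoeff_of_lt (Nat.lt_succ_self n)]; simp
  · obtain ⟨d, rfl⟩ : ∃ d, n = k + 1 + d := ⟨n - (k + 1), by omega⟩
    have hc := Nat.choose_succ_right_eq (k + 1 + d) k
    have hc' : (((k + 1 + d).choose (k + 1) : ℕ) : ℝ) * (k + 1)
        = ((k + 1 + d).choose k : ℝ) * (d + 1) := by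
      have : k + 1 + d - k = d + 1 := by omega
      rw [this] at hc
      exact_mod_cast hc
    simp only [jacobiCoeff]
    rw [show k + 1 + d - k = d + 1 by omega, show k + 1 + d - (k + 1) = d by omega,
      ascPochhammer_eval_succ_left d, ascPochhammer_succ_eval k]
    have e1 : α + ((k + 1 : ℕ) : ℝ) + 1 = α + k + 1 + 1 := by push_cast; ring
    rw [e1]
    push_cast
    have hf : ((k + 1 + d).factorial : ℝ) ≠ 0 := by positivity
    field_simp
    linear_combination (-(k + 1 + α) * (k + 1 + d + k + α + β + 1) *
      (ascPochhammer ℝ k).eval ((k : ℝ) + 1 + d + α + β + 1) *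
      (ascPochhammer ℝ d).eval (α + k + 1 + 1)) * hc'

/-- The hypergeometric differential equation of the Jacobi polynomials. -/
lemma jacobiSeries_ode (n : ℕ) (α β v : ℝ) :
    v * (v + 1) * (Polynomial.derivative (Polynomial.derivative (jacobiSeries n α β))).eval v
      + ((α + 1) + (α + β + 2) * v) * (Polynomial.derivative (jacobiSeries n α β)).eval v
      = n * (n + α + β + 1) * (jacobiSeries n α β).eval v := by
  set p := jacobiSeries n α β with hp
  have key : Polynomial.X * Polynomial.derivative (Polynomial.derivative p)
      + Polynomial.X * (Polynomial.X * Polynomial.derivative (Polynomial.derivative p))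
      + Polynomial.C (α + 1) * Polynomial.derivative p
      + Polynomial.C (α + β + 2) * (Polynomial.X * Polynomial.derivative p)
      = Polynomial.C (n * (n + α + β + 1)) * p := by
    ext k
    have h := jacobiCoeff_rec n α β k
    simp only [Polynomial.coeff_add, Polynomial.coeff_C_mul]
    rcases k with _ | _ | k
    · simp only [Polynomial.mul_coeff_zero, Polynomial.coeff_X_zero, Polynomial.coeff_derivative,
        hp, jacobiSeries_coeff]
      push_cast at h ⊢
      linear_combination -h
    · simp only [Polynomial.coeff_X_mul, Polynomial.mul_coeff_zero, Polynomial.coeff_X_zero,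
        Polynomial.coeff_derivative, hp, jacobiSeries_coeff]
      push_cast at h ⊢
      linear_combination -h
    · simp only [Polynomial.coeff_X_mul, Polynomial.coeff_derivative, hp, jacobiSeries_coeff]
      push_cast at h ⊢
      linear_combination -h
  have := congrArg (Polynomial.eval v) key
  simp only [Polynomial.eval_add, Polynomial.eval_mul, Polynomial.eval_C, Polynomial.eval_X] at this
  linear_combination this

lemma ringChoose_eq_ascPochhammer (r : ℝ) (k : ℕ) :
    Ring.choose r k = (ascPochhammer ℝ k).eval (r - k + 1) / k.factorial := by
  rw [Ring.choose_eq_smul, Polynomial.descPochhammer_smeval_eq_ascPochhammer,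
    Polynomial.ascPochhammer_smeval_eq_eval, smul_eq_mul, div_eq_inv_mul]

lemma jacobiCoeff_eq_choose {n k : ℕ} (h : k ≤ n) (α β : ℝ) :
    jacobiCoeff n α β k = Ring.choose (n + α) (n - k) * Ring.choose (n + α + β + k) k := by
  rw [ringChoose_eq_ascPochhammer, ringChoose_eq_ascPochhammer, jacobiCoeff,
    Nat.cast_choose ℝ h, Nat.cast_sub h]
  have e1 : (n : ℝ) + α - (n - k) + 1 = α + k + 1 := by ring
  have e2 : (n : ℝ) + α + β + k - k + 1 = n + α + β + 1 := by ring
  rw [e1, e2]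
  have hf : (n.factorial : ℝ) ≠ 0 := by positivity
  field_simp

/-- Vandermonde's identity rewrites the coefficients so that the symmetry `x ↦ -x` becomes visible. -/
lemma jacobiCoeff_eq_sum {n k : ℕ} (h : k ≤ n) (α β : ℝ) :
    jacobiCoeff n α β k = ∑ i ∈ Finset.range (k + 1),
      Ring.choose ((n : ℝ) + α) (n - i) * Ring.choose ((n : ℝ) + β) i * ((n - i).choose (k - i)) := by
  rw [jacobiCoeff_eq_choose h, show (n : ℝ) + α + β + k = (n + β) + (α + k) by ring,
    Ring.add_choose_eq k (Commute.all _ _), Finset.Nat.sum_antidiagonal_eq_sum_range_succ_mk,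
    Finset.mul_sum]
  refine Finset.sum_congr rfl fun i hi => ?_
  have hi' : i ≤ k := by simpa [Nat.lt_succ_iff] using hi
  have h1 := Ring.choose_smul_choose ((n : ℝ) + α) (n := n - i) (k := n - k) (by omega)
  rw [show n - i - (n - k) = k - i by omega, Nat.cast_sub h,
    show (n : ℝ) + α - (n - k) = α + k by ring, nsmul_eq_mul] at h1
  have h2 : (n - i).choose (k - i) = (n - i).choose (n - k) :=
    Nat.choose_symm_of_eq_add (by omega)
  rw [h2]
  linear_combination -(Ring.choose ((n : ℝ) + β) i) * h1

/-- `P_n^{(α,β)} = ∑_{i+j=n} binom(n+α,j) binom(n+β,i) v ^ i (1 + v) ^ j` with `v = (x - 1) / 2`. -/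
lemma jacobiSeries_eq_sum (n : ℕ) (α β : ℝ) :
    jacobiSeries n α β = ∑ ij ∈ Finset.HasAntidiagonal.antidiagonal n,
      Polynomial.C (Ring.choose ((n : ℝ) + α) ij.2 * Ring.choose ((n : ℝ) + β) ij.1)
        * (Polynomial.X ^ ij.1 * (1 + Polynomial.X) ^ ij.2) := by
  ext k
  rw [jacobiSeries_coeff, Finset.Nat.sum_antidiagonal_eq_sum_range_succ_mk]
  simp only [Polynomial.finsetSum_coeff, Polynomial.coeff_C_mul, Polynomial.coeff_X_pow_mul',
    Polynomial.coeff_one_add_X_pow]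
  rcases le_or_gt k n with h | h
  · rw [jacobiCoeff_eq_sum h]
    have hsub : Finset.range (k + 1) ⊆ Finset.range (n + 1) :=
      Finset.range_subset_range.2 (by omega)
    rw [← Finset.sum_subset hsub]
    · refine Finset.sum_congr rfl fun i hi => ?_
      rw [if_pos (by simpa [Nat.lt_succ_iff] using hi)]
    · intro i _ hi
      rw [if_neg (by simpa [Nat.lt_succ_iff] using hi), mul_zero]
  · rw [jacobiCoeff_of_lt h]
    symm
    refine Finset.sum_eq_zero fun i hi => ?_
    have hi' : i ≤ n := by simpa [Nat.lt_succ_iff] using hi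
    rw [if_pos (by omega), Nat.choose_eq_zero_of_lt (by omega)]
    simp

lemma jacobiSeries_reflect (n : ℕ) (α β v : ℝ) :
    (jacobiSeries n α β).eval (-1 - v) = (-1) ^ n * (jacobiSeries n β α).eval v := by
  simp only [jacobiSeries_eq_sum, Polynomial.eval_finsetSum, Polynomial.eval_mul, Polynomial.eval_C,
    Polynomial.eval_pow, Polynomial.eval_X, Polynomial.eval_add, Polynomial.eval_one]
  rw [← Finset.Nat.sum_antidiagonal_swap, Finset.mul_sum]
  refine Finset.sum_congr rfl fun ij hij => ?_
  have hn : ij.1 + ij.2 = n := by simpa using hij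
  simp only [Prod.fst_swap, Prod.snd_swap]
  rw [show (1 : ℝ) + (-1 - v) = (-1) * v by ring, show (-1 : ℝ) - v = (-1) * (1 + v) by ring,
    mul_pow, mul_pow, ← hn, pow_add]
  ring

/-- `P_n^{(α,β)}(-x) = (-1)^n P_n^{(β,α)}(x)`, for all real parameters. -/
lemma jacobiPoly_eval_neg (n : ℕ) (α β x : ℝ) :
    (jacobiPoly n α β).eval (-x) = (-1) ^ n * (jacobiPoly n β α).eval x := by
  rw [jacobiPoly_eval, jacobiPoly_eval, ← jacobiSeries_reflect]
  congr 1; ring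

lemma hasDerivAt_jacobiPoly_succ (n : ℕ) (α β x : ℝ) :
    HasDerivAt (fun y => (jacobiPoly (n + 1) α β).eval y)
      ((n + α + β + 2) / 2 * (jacobiPoly n (α + 1) (β + 1)).eval x) x := by
  simp only [jacobiPoly_eval]
  have h1 : HasDerivAt (fun y : ℝ => (y - 1) / 2) (1 / 2) x :=
    ((hasDerivAt_id x).sub_const 1).div_const 2
  have h2 := ((jacobiSeries (n + 1) α β).hasDerivAt ((x - 1) / 2)).comp x h1
  rw [derivative_jacobiSeries_succ, Polynomial.eval_mul, Polynomial.eval_C] at h2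
  exact h2.congr_deriv (by ring)

/-! ### Size of the coefficients and bounds near the endpoint -/

/-- Valid for every real `x`, also where `1 + x` is negative. -/
lemma abs_one_add_le_exp (x : ℝ) : |1 + x| ≤ Real.exp (x + x ^ 2) := by
  have h1 := Real.add_one_le_exp (x + x ^ 2)
  rw [abs_le]
  constructor <;> nlinarith [sq_nonneg (x + 1), sq_nonneg x]

/-- Powers of comparable numbers are comparable, whatever the sign of the exponent. -/
lemma rpow_le_of_comparable {x y c : ℝ} (hx : 0 < x) (hy : 0 < y) (hc : 1 ≤ c) (hxy : x ≤ c * y)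
    (hyx : y ≤ c * x) (s : ℝ) : x ^ s ≤ c ^ |s| * y ^ s := by
  have hc0 : 0 < c := by linarith
  rcases le_total 0 s with hs | hs
  · rw [abs_of_nonneg hs, ← Real.mul_rpow hc0.le hy.le]
    exact Real.rpow_le_rpow hx.le hxy hs
  · rw [abs_of_nonpos hs, Real.rpow_neg hc0.le, ← div_eq_inv_mul, ← Real.div_rpow hy.le hc0.le]
    exact Real.rpow_le_rpow_of_nonpos (by positivity) (by rw [div_le_iff₀ hc0]; linarith) hs

lemma sum_range_inv_sq_le (k d : ℕ) :
    ∑ i ∈ Finset.range d, (((k : ℝ) + 1 + i) ^ 2)⁻¹ ≤ 2 - ((k : ℝ) + d + 1 / 2)⁻¹ := by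
  induction d with
  | zero =>
    have : ((k : ℝ) + (0 : ℕ) + 1 / 2)⁻¹ ≤ 2 := by
      rw [inv_le_comm₀ (by positivity) (by norm_num)]
      have : (0 : ℝ) ≤ k := by positivity
      push_cast; linarith
    simpa using this
  | succ d ih =>
    rw [Finset.sum_range_succ]
    -- telescoping: with `x = k + 1 + d`, `x⁻² ≤ (x - 1 / 2)⁻¹ - (x + 1 / 2)⁻¹`
    have h : (((k : ℝ) + 1 + d) ^ 2)⁻¹ ≤ ((k : ℝ) + d + 1 / 2)⁻¹ - ((k : ℝ) + d + 3 / 2)⁻¹ := by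
      rw [inv_sub_inv (by positivity) (by positivity), inv_eq_one_div,
        div_le_div_iff₀ (by positivity) (by positivity)]
      nlinarith
    have e : ((k : ℝ) + (d + 1 : ℕ) + 1 / 2) = (k : ℝ) + d + 3 / 2 := by push_cast; ring
    rw [e]; linarith

lemma sum_range_inv_eq_harmonic (k d : ℕ) :
    ∑ i ∈ Finset.range d, ((k : ℝ) + 1 + i)⁻¹ = (harmonic (k + d) : ℝ) - harmonic k := by
  induction d with
  | zero => simp
  | succ d ih =>
    rw [Finset.sum_range_succ, ih, ← add_assoc, harmonic_succ]
    push_cast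
    ring

/-- The product `∏_{k < i ≤ n} |1 + α / i|` is dominated by `n ^ α`, up to a factor that is
exponential in `k`; no sign condition on `α` is needed. -/
lemma abs_ascPochhammer_le (α : ℝ) {n k : ℕ} (hn : 1 ≤ n) (hk : k ≤ n) :
    |(ascPochhammer ℝ (n - k)).eval (α + k + 1)| * k.factorial
      ≤ n.factorial * (Real.exp (|α| + 2 * α ^ 2) * (n : ℝ) ^ α * Real.exp |α| ^ k) := by
  obtain ⟨d, rfl⟩ := Nat.exists_eq_add_of_le hk
  rw [Nat.add_sub_cancel_left]
  have h1 : |(ascPochhammer ℝ d).eval (α + k + 1)| * k.factorial ≤ (k + d).factorial *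
      Real.exp (∑ i ∈ Finset.range d, (α * ((k : ℝ) + 1 + i)⁻¹ + α ^ 2 * (((k : ℝ) + 1 + i) ^ 2)⁻¹)) := by
    clear hn hk
    induction d with
    | zero => simp
    | succ d ih =>
      rw [ascPochhammer_succ_eval, Finset.sum_range_succ, Real.exp_add, ← add_assoc,
        Nat.factorial_succ, abs_mul]
      have hpos : (0 : ℝ) < (k : ℝ) + 1 + d := by positivity
      have h2 := abs_one_add_le_exp (α * ((k : ℝ) + 1 + d)⁻¹)
      have h3 : |α + k + 1 + d| = ((k : ℝ) + 1 + d) * |1 + α * ((k : ℝ) + 1 + d)⁻¹| := by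
        rw [← abs_of_pos hpos, ← abs_mul, abs_of_pos hpos]
        congr 1; field_simp; ring
      rw [mul_pow, inv_pow] at h2
      rw [h3]
      calc _ = (|(ascPochhammer ℝ d).eval (α + k + 1)| * k.factorial) *
            (((k : ℝ) + 1 + d) * |1 + α * ((k : ℝ) + 1 + d)⁻¹|) := by ring
        _ ≤ _ := mul_le_mul ih (mul_le_mul_of_nonneg_left h2 hpos.le) (by positivity) (by positivity)
        _ = _ := by push_cast; ring
  refine h1.trans (mul_le_mul_of_nonneg_left ?_ (by positivity))
  have hn0 : (0 : ℝ) < (k + d : ℕ) := by exact_mod_cast hn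
  rw [Real.rpow_def_of_pos hn0, ← Real.exp_nat_mul, ← Real.exp_add, ← Real.exp_add, Real.exp_le_exp,
    Finset.sum_add_distrib, ← Finset.mul_sum, ← Finset.mul_sum, sum_range_inv_eq_harmonic]
  have h4 : ∑ i ∈ Finset.range d, (((k : ℝ) + 1 + i) ^ 2)⁻¹ ≤ 2 :=
    (sum_range_inv_sq_le k d).trans (by
      have : (0 : ℝ) ≤ ((k : ℝ) + d + 1 / 2)⁻¹ := by positivity
      linarith)
  have h5 : α ^ 2 * ∑ i ∈ Finset.range d, (((k : ℝ) + 1 + i) ^ 2)⁻¹ ≤ 2 * α ^ 2 := by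
    nlinarith [sq_nonneg α]
  have h6 : α * ((harmonic (k + d) : ℝ) - harmonic k) ≤ |α| + Real.log (k + d : ℕ) * α + k * |α| := by
    rcases le_total 0 α with ha | ha
    · rw [abs_of_nonneg ha]
      have := harmonic_le_one_add_log (k + d)
      have h0 : (0 : ℝ) ≤ harmonic k := by
        exact_mod_cast (Finset.sum_nonneg fun i _ => by positivity : (0 : ℚ) ≤ harmonic k)
      have hk0 : (0 : ℝ) ≤ k := by positivity
      nlinarith [mul_nonneg ha hk0]
    · rw [abs_of_nonpos ha]
      have h7 := log_add_one_le_harmonic (k + d)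
      have h8 := harmonic_le_one_add_log k
      have h9 : Real.log (k : ℝ) ≤ k := Real.log_le_self (by positivity)
      have h10 : Real.log ((k + d : ℕ) : ℝ) ≤ Real.log ((k + d + 1 : ℕ) : ℝ) :=
        Real.log_le_log hn0 (by push_cast; linarith)
      nlinarith
  linarith

lemma abs_ascPochhammer_le_pow (r : ℝ) (k : ℕ) :
    |(ascPochhammer ℝ k).eval r| ≤ (|r| + k) ^ k := by
  induction k with
  | zero => simp
  | succ k ih =>
    rw [ascPochhammer_succ_eval, abs_mul, pow_succ]
    have h0 : (0 : ℝ) ≤ |r| := abs_nonneg r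
    refine mul_le_mul (ih.trans (pow_le_pow_left₀ (by positivity) (by push_cast; linarith) k)) ?_
      (abs_nonneg _) (by positivity)
    refine (abs_add_le _ _).trans ?_
    rw [Nat.abs_cast]; push_cast; linarith

/-- Near the endpoint `x = 1` the Jacobi polynomials have size `n ^ α`. -/
lemma exists_jacobiSeries_bound_near_zero (α β : ℝ) :
    ∃ C : ℝ, 0 < C ∧ ∀ (n : ℕ) (v : ℝ), 1 ≤ n → |v| ≤ ((n : ℝ) ^ 2)⁻¹ →
      |(jacobiSeries n α β).eval v| ≤ C * (n : ℝ) ^ α := by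
  set b : ℝ := 3 + |α + β| with hb
  have hb0 : 0 < b := by positivity
  refine ⟨Real.exp (|α| + 2 * α ^ 2) * Real.exp (b * Real.exp |α|), by positivity, ?_⟩
  intro n v hn hv
  have hn1 : (1 : ℝ) ≤ n := by exact_mod_cast hn
  simp only [jacobiSeries, Polynomial.eval_finsetSum, Polynomial.eval_monomial]
  calc |∑ k ∈ Finset.range (n + 1), jacobiCoeff n α β k * v ^ k|
      ≤ ∑ k ∈ Finset.range (n + 1), |jacobiCoeff n α β k * v ^ k| := Finset.abs_sum_le_sum_abs _ _
    _ ≤ ∑ k ∈ Finset.range (n + 1), Real.exp (|α| + 2 * α ^ 2) * (n : ℝ) ^ α *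
          ((b * Real.exp |α|) ^ k / k.factorial) := by
        refine Finset.sum_le_sum fun k hk => ?_
        have hk' : k ≤ n := by simpa [Nat.lt_succ_iff] using hk
        have hkn : (k : ℝ) ≤ n := by exact_mod_cast hk'
        have h1 : (n.choose k : ℝ) ≤ (n : ℝ) ^ k / k.factorial := Nat.choose_le_pow_div k n
        have h2 : |(ascPochhammer ℝ k).eval ((n : ℝ) + α + β + 1)| ≤ (b * n) ^ k := by
          refine (abs_ascPochhammer_le_pow _ k).trans (pow_le_pow_left₀ (by positivity) ?_ k)
          have : |(n : ℝ) + α + β + 1| ≤ n + |α + β| + 1 := by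
            rw [abs_le]; constructor <;> linarith [neg_abs_le (α + β), le_abs_self (α + β)]
          nlinarith [abs_nonneg (α + β)]
        have h3 := abs_ascPochhammer_le α hn hk'
        have h4 : |v| ^ k ≤ (((n : ℝ) ^ 2)⁻¹) ^ k := pow_le_pow_left₀ (abs_nonneg v) hv k
        have hf : (0 : ℝ) < k.factorial := by positivity
        have hf1 : (1 : ℝ) ≤ k.factorial := by exact_mod_cast Nat.one_le_iff_ne_zero.2 k.factorial_ne_zero
        have h3' : |(ascPochhammer ℝ (n - k)).eval (α + k + 1)| / n.factorial
            ≤ Real.exp (|α| + 2 * α ^ 2) * (n : ℝ) ^ α * Real.exp |α| ^ k := by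
          rw [div_le_iff₀ (by positivity)]
          nlinarith [abs_nonneg ((ascPochhammer ℝ (n - k)).eval (α + k + 1))]
        rw [abs_mul, abs_pow, jacobiCoeff, mul_div_assoc, abs_mul, abs_mul, abs_div, Nat.abs_cast,
          Nat.abs_cast]
        calc _ ≤ ((n : ℝ) ^ k / k.factorial) * (b * n) ^ k *
              (Real.exp (|α| + 2 * α ^ 2) * (n : ℝ) ^ α * Real.exp |α| ^ k) *
              (((n : ℝ) ^ 2)⁻¹) ^ k := by gcongr
          _ = _ := by
            rw [inv_pow, mul_pow, mul_pow]
            field_simp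
            rw [← pow_mul, ← pow_mul, mul_comm]
    _ = Real.exp (|α| + 2 * α ^ 2) * (n : ℝ) ^ α *
          ∑ k ∈ Finset.range (n + 1), (b * Real.exp |α|) ^ k / k.factorial := by rw [Finset.mul_sum]
    _ ≤ Real.exp (|α| + 2 * α ^ 2) * (n : ℝ) ^ α * Real.exp (b * Real.exp |α|) :=
        mul_le_mul_of_nonneg_left (Real.sum_le_exp_of_nonneg (by positivity) _) (by positivity)
    _ = _ := by ring

lemma exists_derivative_jacobiSeries_bound_near_zero (α β : ℝ) :
    ∃ C : ℝ, 0 < C ∧ ∀ (n : ℕ) (v : ℝ), 2 ≤ n → |v| ≤ ((n : ℝ) ^ 2)⁻¹ →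
      |(Polynomial.derivative (jacobiSeries n α β)).eval v| ≤ C * (n : ℝ) ^ (α + 2) := by
  obtain ⟨C, hC, h⟩ := exists_jacobiSeries_bound_near_zero (α + 1) (β + 1)
  refine ⟨(2 + |α + β|) * (C * 2 ^ |α + 1|), by positivity, ?_⟩
  intro n v hn hv
  obtain ⟨m, rfl⟩ : ∃ m, n = m + 1 := ⟨n - 1, by omega⟩
  have hm : (1 : ℝ) ≤ m := by exact_mod_cast (by omega : 1 ≤ m)
  rw [derivative_jacobiSeries_succ, Polynomial.eval_mul, Polynomial.eval_C, abs_mul]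
  have hv' : |v| ≤ ((m : ℝ) ^ 2)⁻¹ := hv.trans (by push_cast; gcongr; linarith)
  have h1 := h m v (by omega) hv'
  have h2 : (m : ℝ) ^ (α + 1) ≤ 2 ^ |α + 1| * ((m + 1 : ℕ) : ℝ) ^ (α + 1) :=
    rpow_le_of_comparable (by positivity) (by positivity) (by norm_num) (by push_cast; linarith)
      (by push_cast; linarith) _
  have h3 : |(m : ℝ) + α + β + 2| ≤ (2 + |α + β|) * ((m + 1 : ℕ) : ℝ) := by
    have h0 := abs_nonneg (α + β)
    have h1 := le_abs_self (α + β)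
    have h2 := neg_abs_le (α + β)
    push_cast
    rw [abs_le]; constructor <;> nlinarith
  have h4 : ((m + 1 : ℕ) : ℝ) ^ (α + 2) = ((m + 1 : ℕ) : ℝ) * ((m + 1 : ℕ) : ℝ) ^ (α + 1) := by
    rw [show α + 2 = 1 + (α + 1) by ring, Real.rpow_add (by positivity), Real.rpow_one]
  rw [h4]
  calc _ ≤ ((2 + |α + β|) * ((m + 1 : ℕ) : ℝ)) * (C * (2 ^ |α + 1| * ((m + 1 : ℕ) : ℝ) ^ (α + 1))) :=
        mul_le_mul h3 (h1.trans (by gcongr)) (abs_nonneg _) (by positivity)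
    _ = _ := by ring

/-! ### The energy of the Liouville normal form -/

/-- The Jacobi polynomial at `cos (2 θ)`. -/
noncomputable def jacobiAngle (n : ℕ) (α β θ : ℝ) : ℝ :=
  (jacobiSeries n α β).eval (-(Real.sin θ) ^ 2)

/-- The `θ`-derivative of `jacobiAngle`. -/
noncomputable def jacobiAngleDeriv (n : ℕ) (α β θ : ℝ) : ℝ :=
  -2 * Real.sin θ * Real.cos θ *
    (Polynomial.derivative (jacobiSeries n α β)).eval (-(Real.sin θ) ^ 2)

/-- Half of the first-order coefficient of the Jacobi equation
`y'' + 2 q y' + 4 n (n + α + β + 1) y = 0` in the variable `θ`. -/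
noncomputable def jacobiDrift (α β θ : ℝ) : ℝ :=
  (α + 1 / 2) * (Real.cos θ / Real.sin θ) - (β + 1 / 2) * (Real.sin θ / Real.cos θ)

/-- The weight with logarithmic derivative `2 * jacobiDrift α β`. -/
noncomputable def jacobiAngleWeight (α β θ : ℝ) : ℝ :=
  Real.sin θ ^ (2 * α + 1) * Real.cos θ ^ (2 * β + 1)

/-- The energy of `u = √W y`, the solution of the Liouville normal form of the Jacobi equation:
`E = u' ^ 2 + 4 λ u ^ 2`, where `u' = √W (y' + q y)` and `λ = n (n + α + β + 1)`. -/
noncomputable def jacobiEnergy (n : ℕ) (α β θ : ℝ) : ℝ :=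
  jacobiAngleWeight α β θ *
    ((jacobiAngleDeriv n α β θ + jacobiDrift α β θ * jacobiAngle n α β θ) ^ 2
      + 4 * (n * (n + α + β + 1)) * jacobiAngle n α β θ ^ 2)

lemma hasDerivAt_jacobiAngle (n : ℕ) (α β θ : ℝ) :
    HasDerivAt (jacobiAngle n α β) (jacobiAngleDeriv n α β θ) θ := by
  have h1 : HasDerivAt (fun θ => -(Real.sin θ) ^ 2) (-(2 * Real.sin θ * Real.cos θ)) θ := by
    have := ((Real.hasDerivAt_sin θ).pow 2).neg
    exact this.congr_deriv (by simp)
  have h2 := ((jacobiSeries n α β).hasDerivAt (-(Real.sin θ) ^ 2)).comp θ h1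
  exact h2.congr_deriv (by rw [jacobiAngleDeriv]; ring)

lemma hasDerivAt_jacobiAngleDeriv (n : ℕ) (α β : ℝ) {θ : ℝ} (hs : Real.sin θ ≠ 0)
    (hc : Real.cos θ ≠ 0) :
    HasDerivAt (jacobiAngleDeriv n α β) (-2 * jacobiDrift α β θ * jacobiAngleDeriv n α β θ
      - 4 * (n * (n + α + β + 1)) * jacobiAngle n α β θ) θ := by
  have h1 : HasDerivAt (fun θ => -(Real.sin θ) ^ 2) (-(2 * Real.sin θ * Real.cos θ)) θ := by
    have := ((Real.hasDerivAt_sin θ).pow 2).neg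
    exact this.congr_deriv (by simp)
  have h2 := ((Polynomial.derivative (jacobiSeries n α β)).hasDerivAt (-(Real.sin θ) ^ 2)).comp θ h1
  have h3 := (((Real.hasDerivAt_sin θ).const_mul (-2)).mul (Real.hasDerivAt_cos θ)).mul h2
  have hode := jacobiSeries_ode n α β (-(Real.sin θ) ^ 2)
  have hsc := Real.sin_sq_add_cos_sq θ
  refine h3.congr_deriv ?_
  simp only [jacobiDrift, jacobiAngleDeriv, jacobiAngle, Function.comp, Pi.mul_apply]
  set s := Real.sin θ
  set c := Real.cos θ
  set p0 := (jacobiSeries n α β).eval (-s ^ 2)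
  set p1 := (Polynomial.derivative (jacobiSeries n α β)).eval (-s ^ 2)
  set p2 := (Polynomial.derivative (Polynomial.derivative (jacobiSeries n α β))).eval (-s ^ 2)
  have hc2 : c ^ 2 = 1 - s ^ 2 := by linarith
  field_simp
  linear_combination (-4) * hode + (4 * p2 * s ^ 2 - (4 * α + 4) * p1) * hc2

lemma hasDerivAt_jacobiDrift (α β : ℝ) {θ : ℝ} (hs : Real.sin θ ≠ 0) (hc : Real.cos θ ≠ 0) :
    HasDerivAt (jacobiDrift α β)
      (-(α + 1 / 2) / Real.sin θ ^ 2 - (β + 1 / 2) / Real.cos θ ^ 2) θ := by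
  have h1 := (((Real.hasDerivAt_cos θ).div (Real.hasDerivAt_sin θ) hs).const_mul (α + 1 / 2)).sub
    (((Real.hasDerivAt_sin θ).div (Real.hasDerivAt_cos θ) hc).const_mul (β + 1 / 2))
  refine h1.congr_deriv ?_
  have hsc := Real.sin_sq_add_cos_sq θ
  have e1 : -Real.sin θ * Real.sin θ - Real.cos θ * Real.cos θ = -1 := by linarith
  have e2 : Real.cos θ * Real.cos θ - Real.sin θ * -Real.sin θ = 1 := by linarith
  rw [e1, e2]; ring

lemma hasDerivAt_jacobiAngleWeight (α β : ℝ) {θ : ℝ} (hs : 0 < Real.sin θ) (hc : 0 < Real.cos θ) :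
    HasDerivAt (jacobiAngleWeight α β) (2 * jacobiDrift α β θ * jacobiAngleWeight α β θ) θ := by
  have h1 := ((Real.hasDerivAt_sin θ).rpow_const (p := 2 * α + 1) (Or.inl hs.ne')).mul
    ((Real.hasDerivAt_cos θ).rpow_const (p := 2 * β + 1) (Or.inl hc.ne'))
  refine h1.congr_deriv ?_
  rw [Real.rpow_sub_one hs.ne', Real.rpow_sub_one hc.ne', jacobiDrift, jacobiAngleWeight]
  field_simp
  ring

lemma hasDerivAt_jacobiEnergy (n : ℕ) (α β : ℝ) {θ : ℝ} (hs : 0 < Real.sin θ)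
    (hc : 0 < Real.cos θ) :
    HasDerivAt (jacobiEnergy n α β) (2 * jacobiAngleWeight α β θ *
      (jacobiDrift α β θ ^ 2
        + (-(α + 1 / 2) / Real.sin θ ^ 2 - (β + 1 / 2) / Real.cos θ ^ 2)) *
      (jacobiAngle n α β θ *
        (jacobiAngleDeriv n α β θ + jacobiDrift α β θ * jacobiAngle n α β θ))) θ := by
  have hy := hasDerivAt_jacobiAngle n α β θ
  have hy' := hasDerivAt_jacobiAngleDeriv n α β hs.ne' hc.ne'
  have hq := hasDerivAt_jacobiDrift α β hs.ne' hc.ne'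
  have hw := hasDerivAt_jacobiAngleWeight α β hs hc
  have h := hw.mul (((hy'.add (hq.mul hy)).pow 2).add
    ((hy.pow 2).const_mul (4 * (n * (n + α + β + 1) : ℝ))))
  refine h.congr_deriv ?_
  simp only [Pi.add_apply, Pi.mul_apply, Pi.pow_apply]
  push_cast
  ring

lemma half_le_sin {θ : ℝ} (h0 : 0 ≤ θ) (h1 : θ ≤ Real.pi / 4) : θ / 2 ≤ Real.sin θ := by
  have h := Real.mul_le_sin h0 (by linarith [Real.pi_pos])
  have : 1 / 2 ≤ 2 / Real.pi := by
    rw [div_le_div_iff₀ (by norm_num) Real.pi_pos]; linarith [Real.pi_le_four]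
  nlinarith

lemma half_le_cos {θ : ℝ} (h0 : 0 ≤ θ) (h1 : θ ≤ Real.pi / 4) : 1 / 2 ≤ Real.cos θ := by
  have h := Real.cos_le_cos_of_nonneg_of_le_pi h0 (by linarith [Real.pi_pos] : Real.pi / 3 ≤ Real.pi)
    (by linarith [Real.pi_pos])
  rwa [Real.cos_pi_div_three] at h

lemma abs_jacobiDrift_le (α β : ℝ) {θ : ℝ} (h0 : 0 < θ) (h1 : θ ≤ Real.pi / 4) :
    |jacobiDrift α β θ| ≤ (2 * |α + 1 / 2| + 2 * |β + 1 / 2|) / θ := by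
  have hs := half_le_sin h0.le h1
  have hc := half_le_cos h0.le h1
  have hθ1 : θ ≤ 1 := by linarith [Real.pi_le_four]
  have hs0 : 0 < Real.sin θ := by linarith
  have hc0 : 0 < Real.cos θ := by linarith
  have e1 : Real.cos θ / Real.sin θ ≤ 2 / θ := by
    rw [div_le_div_iff₀ hs0 h0]; nlinarith [Real.cos_le_one θ]
  have e2 : Real.sin θ / Real.cos θ ≤ 2 / θ := by
    rw [div_le_div_iff₀ hc0 h0]; nlinarith [Real.sin_le_one θ]
  rw [jacobiDrift]
  refine (abs_sub _ _).trans ?_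
  rw [abs_mul, abs_mul, abs_of_pos (div_pos hc0 hs0), abs_of_pos (div_pos hs0 hc0)]
  calc _ ≤ |α + 1 / 2| * (2 / θ) + |β + 1 / 2| * (2 / θ) := by gcongr
    _ = _ := by ring

lemma abs_jacobiDrift_sq_add_deriv_le (α β : ℝ) : ∃ K : ℝ, 0 ≤ K ∧
    ∀ θ : ℝ, 0 < θ → θ ≤ Real.pi / 4 →
      |jacobiDrift α β θ ^ 2 + (-(α + 1 / 2) / Real.sin θ ^ 2 - (β + 1 / 2) / Real.cos θ ^ 2)|
        ≤ K / θ ^ 2 := by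
  refine ⟨(2 * |α + 1 / 2| + 2 * |β + 1 / 2|) ^ 2 + (4 * |α + 1 / 2| + 4 * |β + 1 / 2|),
    by positivity, fun θ h0 h1 => ?_⟩
  have hs := half_le_sin h0.le h1
  have hc := half_le_cos h0.le h1
  have hθ1 : θ ≤ 1 := by linarith [Real.pi_le_four]
  have hs0 : 0 < Real.sin θ := by linarith
  have hc0 : 0 < Real.cos θ := by linarith
  have e1 : 1 / Real.sin θ ^ 2 ≤ 4 / θ ^ 2 := by
    rw [div_le_div_iff₀ (by positivity) (by positivity)]; nlinarith
  have e2 : 1 / Real.cos θ ^ 2 ≤ 4 / θ ^ 2 := by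
    rw [div_le_div_iff₀ (by positivity) (by positivity)]; nlinarith
  have e3 : jacobiDrift α β θ ^ 2 ≤ ((2 * |α + 1 / 2| + 2 * |β + 1 / 2|) / θ) ^ 2 :=
    sq_le_sq' (by linarith [neg_abs_le (jacobiDrift α β θ), abs_jacobiDrift_le α β h0 h1])
      ((le_abs_self _).trans (abs_jacobiDrift_le α β h0 h1))
  refine (abs_add_le _ _).trans ?_
  rw [abs_of_nonneg (sq_nonneg (jacobiDrift α β θ))]
  have e4 : |-(α + 1 / 2) / Real.sin θ ^ 2 - (β + 1 / 2) / Real.cos θ ^ 2|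
      ≤ |α + 1 / 2| * (4 / θ ^ 2) + |β + 1 / 2| * (4 / θ ^ 2) := by
    refine (abs_sub _ _).trans ?_
    rw [abs_div, abs_div, abs_neg, abs_of_pos (by positivity : 0 < Real.sin θ ^ 2),
      abs_of_pos (by positivity : 0 < Real.cos θ ^ 2), div_eq_mul_one_div, div_eq_mul_one_div |β + 1 / 2|]
    gcongr
  calc _ ≤ ((2 * |α + 1 / 2| + 2 * |β + 1 / 2|) / θ) ^ 2
        + (|α + 1 / 2| * (4 / θ ^ 2) + |β + 1 / 2| * (4 / θ ^ 2)) := add_le_add e3 e4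
    _ = _ := by rw [div_pow]; ring

/-- Gronwall's inequality for the Liouville energy: on `[1 / n, π / 4]` the energy grows at most by
a constant factor, because `∫ K / (n θ ^ 2) dθ ≤ K` there. -/
lemma exists_jacobiEnergy_le (α β : ℝ) : ∃ C : ℝ, 0 < C ∧ ∀ (n : ℕ) (θ : ℝ), 2 ≤ n →
    2 * |α + β + 1| ≤ n → (n : ℝ)⁻¹ ≤ θ → θ ≤ Real.pi / 4 →
      jacobiEnergy n α β θ ≤ C * jacobiEnergy n α β (n : ℝ)⁻¹ := by
  obtain ⟨K, hK, hbound⟩ := abs_jacobiDrift_sq_add_deriv_le α β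
  refine ⟨Real.exp K, Real.exp_pos K, fun n θ hn hlarge hθ0 hθ1 => ?_⟩
  have hn0 : (0 : ℝ) < n := by exact_mod_cast (by omega : 0 < n)
  set lam : ℝ := n * (n + α + β + 1) with hlam
  have hlam1 : (n : ℝ) ^ 2 / 4 ≤ lam := by
    have := neg_abs_le (α + β + 1)
    nlinarith
  set e : ℝ := K / n with he
  -- `θ ↦ exp (e / θ)` is the integrating factor: its logarithmic derivative is `-e / θ ^ 2`
  set F : ℝ → ℝ := fun θ => jacobiEnergy n α β θ * Real.exp (e * θ⁻¹) with hF
  have hpos : ∀ t ∈ Set.Icc (n : ℝ)⁻¹ (Real.pi / 4), 0 < t ∧ t ≤ Real.pi / 4 := fun t ht =>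
    ⟨lt_of_lt_of_le (by positivity) ht.1, ht.2⟩
  have hder : ∀ t ∈ Set.Icc (n : ℝ)⁻¹ (Real.pi / 4), ∃ F' ≤ 0, HasDerivAt F F' t := by
    intro t ht
    obtain ⟨ht0, ht1⟩ := hpos t ht
    have hs0 : 0 < Real.sin t := by linarith [half_le_sin ht0.le ht1]
    have hc0 : 0 < Real.cos t := by linarith [half_le_cos ht0.le ht1]
    have h1 := hasDerivAt_jacobiEnergy n α β hs0 hc0
    have h2 : HasDerivAt (fun θ : ℝ => Real.exp (e * θ⁻¹))
        (Real.exp (e * t⁻¹) * (e * -(t ^ 2)⁻¹)) t :=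
      ((hasDerivAt_inv ht0.ne').const_mul e).exp
    refine ⟨_, ?_, h1.mul h2⟩
    have hb := hbound t ht0 ht1
    set Q := jacobiDrift α β t ^ 2 + (-(α + 1 / 2) / Real.sin t ^ 2 - (β + 1 / 2) / Real.cos t ^ 2)
    set y := jacobiAngle n α β t
    set z := jacobiAngleDeriv n α β t + jacobiDrift α β t * y with hz
    have hW : 0 ≤ jacobiAngleWeight α β t := by rw [jacobiAngleWeight]; positivity
    set W := jacobiAngleWeight α β t
    have hE : jacobiEnergy n α β t = W * (z ^ 2 + 4 * lam * y ^ 2) := rfl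
    rw [hE]
    have h3 : Q * (y * z) ≤ K / t ^ 2 * (|y| * |z|) :=
      (le_abs_self _).trans (by rw [abs_mul, abs_mul]; gcongr)
    -- `4 λ ≥ n ^ 2`, so that `2 |y z|` costs a factor `1 / n` against the energy
    have h4 : 2 * (|y| * |z|) ≤ (n : ℝ)⁻¹ * (z ^ 2 + 4 * lam * y ^ 2) := by
      rw [← div_eq_inv_mul, le_div_iff₀ hn0]
      have := sq_nonneg ((n : ℝ) * |y| - |z|)
      nlinarith [sq_abs y, sq_abs z, sq_nonneg y]
    have h5 : 2 * (Q * (y * z)) ≤ e * (t ^ 2)⁻¹ * (z ^ 2 + 4 * lam * y ^ 2) := by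
      calc 2 * (Q * (y * z)) ≤ K / t ^ 2 * (2 * (|y| * |z|)) := by linarith
        _ ≤ K / t ^ 2 * ((n : ℝ)⁻¹ * (z ^ 2 + 4 * lam * y ^ 2)) := by gcongr
        _ = _ := by rw [he]; ring
    have h6 : 0 ≤ W * Real.exp (e * t⁻¹) := by positivity
    nlinarith [mul_le_mul_of_nonneg_left h5 h6]
  have hanti : AntitoneOn F (Set.Icc (n : ℝ)⁻¹ (Real.pi / 4)) := by
    refine antitoneOn_of_deriv_nonpos (convex_Icc _ _) ?_ ?_ ?_
    · intro t ht
      obtain ⟨_, _, h⟩ := hder t ht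
      exact h.continuousAt.continuousWithinAt
    · intro t ht
      obtain ⟨_, _, h⟩ := hder t (interior_subset ht)
      exact h.differentiableAt.differentiableWithinAt
    · intro t ht
      obtain ⟨_, h0, h⟩ := hder t (interior_subset ht)
      rw [h.deriv]; exact h0
  have hmain : F θ ≤ F (n : ℝ)⁻¹ :=
    hanti ⟨le_rfl, hθ0.trans hθ1⟩ ⟨hθ0, hθ1⟩ hθ0
  obtain ⟨hθpos, _⟩ := hpos θ ⟨hθ0, hθ1⟩
  have hW : 0 ≤ jacobiEnergy n α β θ := by
    have hs0 : 0 < Real.sin θ := by linarith [half_le_sin hθpos.le hθ1]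
    have hc0 : 0 < Real.cos θ := by linarith [half_le_cos hθpos.le hθ1]
    rw [jacobiEnergy, jacobiAngleWeight]
    have : 0 ≤ lam := le_trans (by positivity) hlam1
    positivity
  have e1 : F (n : ℝ)⁻¹ = Real.exp K * jacobiEnergy n α β (n : ℝ)⁻¹ := by
    simp only [hF, he, inv_inv]
    rw [div_mul_cancel₀ _ hn0.ne', mul_comm]
  rw [← e1]
  refine le_trans ?_ hmain
  exact le_mul_of_one_le_right hW (Real.one_le_exp (by positivity))

/-! ### Szegő's bound -/

/-- Szegő's bound away from the endpoint, in the angular variable: the energy is of order `n`. -/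
lemma exists_jacobiAngle_bound (α β : ℝ) : ∃ C : ℝ, 0 < C ∧ ∀ (n : ℕ) (θ : ℝ), 2 ≤ n →
    2 * |α + β + 1| ≤ n → (n : ℝ)⁻¹ ≤ θ → θ ≤ Real.pi / 4 →
      |jacobiAngle n α β θ| ≤ C * ((n : ℝ) ^ (-(1 / 2 : ℝ)) * θ ^ (-α - 1 / 2)) := by
  obtain ⟨C1, hC1, hE⟩ := exists_jacobiEnergy_le α β
  obtain ⟨C2, hC2, hp⟩ := exists_jacobiSeries_bound_near_zero α β
  obtain ⟨C3, hC3, hp'⟩ := exists_derivative_jacobiSeries_bound_near_zero α β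
  set K := 2 * |α + 1 / 2| + 2 * |β + 1 / 2| with hK
  set V := (2 : ℝ) ^ |2 * α + 1| * 2 ^ |2 * β + 1| with hV
  have hK0 : 0 ≤ K := by positivity
  have hV0 : 0 < V := by positivity
  set M := (2 * C3 + K * C2) ^ 2 + 8 * C2 ^ 2 with hM
  have hM0 : 0 < M := by positivity
  refine ⟨√(V * (C1 * (V * M))), by positivity, fun n θ hn hlarge hθ0 hθ1 => ?_⟩
  have hn0 : (0 : ℝ) < n := by exact_mod_cast (by omega : 0 < n)
  have hn2 : (2 : ℝ) ≤ n := by exact_mod_cast hn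
  have hθpos : 0 < θ := lt_of_lt_of_le (by positivity) hθ0
  set lam : ℝ := n * (n + α + β + 1) with hlam
  have hlam1 : (n : ℝ) ^ 2 / 4 ≤ lam := by
    have := neg_abs_le (α + β + 1)
    nlinarith
  have hlam2 : lam ≤ 2 * (n : ℝ) ^ 2 := by
    have := le_abs_self (α + β + 1)
    nlinarith
  -- the weight is comparable to `t ^ (2 α + 1)`, in both directions
  have hsin : ∀ t, 0 < t → t ≤ Real.pi / 4 → ∀ s : ℝ,
      Real.sin t ^ s ≤ 2 ^ |s| * t ^ s ∧ t ^ s ≤ 2 ^ |s| * Real.sin t ^ s := by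
    intro t h0 h1 s
    have h2 := half_le_sin h0.le h1
    have h3 := (Real.sin_lt h0).le
    exact ⟨rpow_le_of_comparable (by linarith) h0 (by norm_num) (by linarith) (by linarith) s,
      rpow_le_of_comparable h0 (by linarith) (by norm_num) (by linarith) (by linarith) s⟩
  have hcos : ∀ t, 0 < t → t ≤ Real.pi / 4 → ∀ s : ℝ,
      Real.cos t ^ s ≤ 2 ^ |s| ∧ 1 ≤ 2 ^ |s| * Real.cos t ^ s := by
    intro t h0 h1 s
    have h2 := half_le_cos h0.le h1
    have h3 := Real.cos_le_one t
    have h4 := rpow_le_of_comparable (by linarith : 0 < Real.cos t) one_pos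
      (by norm_num : (1 : ℝ) ≤ 2) (by linarith) (by linarith) s
    have h5 := rpow_le_of_comparable one_pos (by linarith : 0 < Real.cos t)
      (by norm_num : (1 : ℝ) ≤ 2) (by linarith) (by linarith) s
    rw [Real.one_rpow] at h4 h5
    exact ⟨by simpa using h4, h5⟩
  have hWle : ∀ t, 0 < t → t ≤ Real.pi / 4 →
      jacobiAngleWeight α β t ≤ V * t ^ (2 * α + 1) := by
    intro t h0 h1
    have hs := (hsin t h0 h1 (2 * α + 1)).1
    have hc := (hcos t h0 h1 (2 * β + 1)).1
    have hc0 : 0 < Real.cos t := by linarith [half_le_cos h0.le h1]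
    calc jacobiAngleWeight α β t ≤ (2 ^ |2 * α + 1| * t ^ (2 * α + 1)) * 2 ^ |2 * β + 1| :=
          mul_le_mul hs hc (by positivity) (by positivity)
      _ = _ := by rw [hV]; ring
  have hleW : ∀ t, 0 < t → t ≤ Real.pi / 4 →
      t ^ (2 * α + 1) ≤ V * jacobiAngleWeight α β t := by
    intro t h0 h1
    have hs := (hsin t h0 h1 (2 * α + 1)).2
    have hc := (hcos t h0 h1 (2 * β + 1)).2
    have hs0 : 0 < Real.sin t := by linarith [half_le_sin h0.le h1]
    calc t ^ (2 * α + 1) = t ^ (2 * α + 1) * 1 := (mul_one _).symm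
      _ ≤ (2 ^ |2 * α + 1| * Real.sin t ^ (2 * α + 1)) *
          (2 ^ |2 * β + 1| * Real.cos t ^ (2 * β + 1)) :=
          mul_le_mul hs hc zero_le_one (by positivity)
      _ = _ := by rw [hV, jacobiAngleWeight]; ring
  -- the energy at `1 / n`
  have hE0 : jacobiEnergy n α β (n : ℝ)⁻¹ ≤ V * M * n := by
    set t := (n : ℝ)⁻¹ with ht
    have h0 : 0 < t := by positivity
    have h1 : t ≤ Real.pi / 4 := hθ0.trans hθ1
    have hs0 : 0 < Real.sin t := by linarith [half_le_sin h0.le h1]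
    have hst := (Real.sin_lt h0).le
    have hc0 : 0 < Real.cos t := by linarith [half_le_cos h0.le h1]
    have hv : |-(Real.sin t) ^ 2| ≤ ((n : ℝ) ^ 2)⁻¹ := by
      rw [abs_neg, abs_of_nonneg (by positivity), ← inv_pow]
      exact pow_le_pow_left₀ hs0.le hst 2
    have hy : |jacobiAngle n α β t| ≤ C2 * (n : ℝ) ^ α := hp n _ (by omega) hv
    have hy' : |jacobiAngleDeriv n α β t| ≤ 2 * C3 * (n * (n : ℝ) ^ α) := by
      rw [jacobiAngleDeriv, abs_mul, abs_mul, abs_mul, abs_neg, abs_two, abs_of_pos hs0,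
        abs_of_pos hc0]
      calc _ ≤ 2 * t * 1 * (C3 * (n : ℝ) ^ (α + 2)) := by
            gcongr
            · exact Real.cos_le_one t
            · exact hp' n _ hn hv
        _ = _ := by
            rw [show α + 2 = α + 1 + 1 by ring, Real.rpow_add_one hn0.ne',
              Real.rpow_add_one hn0.ne', ht]
            field_simp
    have hq : |jacobiDrift α β t| ≤ K * n := by
      have := abs_jacobiDrift_le α β h0 h1
      rwa [ht, div_inv_eq_mul] at this
    have hz : |jacobiAngleDeriv n α β t + jacobiDrift α β t * jacobiAngle n α β t|
        ≤ (2 * C3 + K * C2) * (n * (n : ℝ) ^ α) := by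
      refine (abs_add_le _ _).trans ?_
      rw [abs_mul]
      calc _ ≤ 2 * C3 * (n * (n : ℝ) ^ α) + (K * n) * (C2 * (n : ℝ) ^ α) := by gcongr
        _ = _ := by ring
    have hz2 := pow_le_pow_left₀ (abs_nonneg _) hz 2
    have hy2 := pow_le_pow_left₀ (abs_nonneg _) hy 2
    rw [sq_abs] at hz2 hy2
    have hW := hWle t h0 h1
    have hsum : (jacobiAngleDeriv n α β t + jacobiDrift α β t * jacobiAngle n α β t) ^ 2
        + 4 * lam * jacobiAngle n α β t ^ 2 ≤ M * (n * (n : ℝ) ^ α) ^ 2 := by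
      calc _ ≤ ((2 * C3 + K * C2) * (n * (n : ℝ) ^ α)) ^ 2
            + 4 * (2 * (n : ℝ) ^ 2) * (C2 * (n : ℝ) ^ α) ^ 2 := by gcongr
        _ = _ := by rw [hM]; ring
    have hlam0 : 0 ≤ lam := le_trans (by positivity) hlam1
    calc jacobiEnergy n α β t ≤ (V * t ^ (2 * α + 1)) * (M * (n * (n : ℝ) ^ α) ^ 2) :=
          mul_le_mul hW hsum (by positivity) (by positivity)
      _ = _ := by
        rw [ht, Real.inv_rpow hn0.le, Real.rpow_add_one hn0.ne', mul_comm 2 α,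
          Real.rpow_mul hn0.le, Real.rpow_two]
        field_simp
  have hfin := (hE n θ hn hlarge hθ0 hθ1).trans (mul_le_mul_of_nonneg_left hE0 hC1.le)
  have hs0 : 0 < Real.sin θ := by linarith [half_le_sin hθpos.le hθ1]
  have hc0 : 0 < Real.cos θ := by linarith [half_le_cos hθpos.le hθ1]
  have hWpos : 0 < jacobiAngleWeight α β θ := by rw [jacobiAngleWeight]; positivity
  set y := jacobiAngle n α β θ
  have hlow : jacobiAngleWeight α β θ * ((n : ℝ) ^ 2 * y ^ 2) ≤ jacobiEnergy n α β θ := by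
    rw [jacobiEnergy]
    refine mul_le_mul_of_nonneg_left ?_ hWpos.le
    nlinarith [sq_nonneg (jacobiAngleDeriv n α β θ + jacobiDrift α β θ * y), sq_nonneg y]
  have hy2 : θ ^ (2 * α + 1) * (n * y ^ 2) ≤ V * (C1 * (V * M)) := by
    have h1 := mul_le_mul_of_nonneg_right (hleW θ hθpos hθ1)
      (by positivity : 0 ≤ (n : ℝ) * y ^ 2)
    have h2 : jacobiAngleWeight α β θ * (n * y ^ 2) ≤ C1 * (V * M) := by
      have := hlow.trans hfin
      have h3 : (jacobiAngleWeight α β θ * (n * y ^ 2)) * n ≤ (C1 * (V * M)) * n := by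
        calc _ = jacobiAngleWeight α β θ * ((n : ℝ) ^ 2 * y ^ 2) := by ring
          _ ≤ _ := this
          _ = _ := by ring
      exact le_of_mul_le_mul_right h3 hn0
    calc _ ≤ V * jacobiAngleWeight α β θ * (n * y ^ 2) := h1
      _ = V * (jacobiAngleWeight α β θ * (n * y ^ 2)) := by ring
      _ ≤ _ := by gcongr
  refine abs_le_of_sq_le_sq ?_ (by positivity)
  rw [mul_pow, Real.sq_sqrt (by positivity), mul_pow, ← Real.rpow_natCast ((n : ℝ) ^ _),
    ← Real.rpow_natCast (θ ^ _), ← Real.rpow_mul hn0.le, ← Real.rpow_mul hθpos.le,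
    show -(1 / 2 : ℝ) * (2 : ℕ) = -1 by norm_num,
    show (-α - 1 / 2) * ((2 : ℕ) : ℝ) = -(2 * α + 1) by push_cast; ring,
    Real.rpow_neg hn0.le, Real.rpow_neg hθpos.le, Real.rpow_one, ← mul_inv, ← div_eq_mul_inv,
    le_div_iff₀ (by positivity)]
  calc _ = θ ^ (2 * α + 1) * (n * y ^ 2) := by ring
    _ ≤ _ := hy2

/-- The length scale `ε √(1 - |y|) + ε²` on which a function of frequency `1 / ε` in the angular
variable `arccos y` oscillates near the point `y` of `[-1, 1]`. -/
noncomputable def oscScale (ε y : ℝ) : ℝ := ε * √(1 - |y|) + ε ^ 2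

lemma oscScale_pos {ε : ℝ} (hε : 0 < ε) (y : ℝ) : 0 < oscScale ε y := by
  rw [oscScale]; positivity

lemma exists_jacobiPoly_bound_nonneg (α β : ℝ) : ∃ C : ℝ, 0 < C ∧ ∀ (n : ℕ) (t : ℝ), 2 ≤ n →
    2 * |α + β + 1| ≤ n → 0 ≤ t → t ≤ 1 → |(jacobiPoly n α β).eval t|
      ≤ C * ((n : ℝ) ^ (-α - 1) * oscScale (n : ℝ)⁻¹ t ^ (-α - 1 / 2)) := by
  obtain ⟨C1, hC1, h1⟩ := exists_jacobiAngle_bound α β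
  obtain ⟨C2, hC2, h2⟩ := exists_jacobiSeries_bound_near_zero α β
  refine ⟨(C1 + C2) * 3 ^ |-α - 1 / 2|, by positivity, fun n t hn hlarge ht0 ht1 => ?_⟩
  have hn0 : (0 : ℝ) < n := by exact_mod_cast (by omega : 0 < n)
  set θ := Real.arccos t / 2 with hθ
  have hθ0 : 0 ≤ θ := by have := Real.arccos_nonneg t; positivity
  have hθ1 : θ ≤ Real.pi / 4 := by
    have := Real.arccos_le_pi_div_two.2 ht0
    rw [hθ]; linarith
  have htθ : 1 - t = 2 * Real.sin θ ^ 2 := by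
    have h3 : Real.cos (2 * θ) = t := by
      rw [hθ, mul_div_cancel₀ _ (by norm_num : (2 : ℝ) ≠ 0), Real.cos_arccos (by linarith) ht1]
    rw [Real.cos_two_mul, Real.cos_sq'] at h3
    linarith
  have hval : (jacobiPoly n α β).eval t = jacobiAngle n α β θ := by
    rw [jacobiPoly_eval, jacobiAngle]
    congr 1; linarith
  have hsin0 := half_le_sin hθ0 hθ1
  have hsin1 := Real.sin_le hθ0
  have hsc : oscScale (n : ℝ)⁻¹ t = (n : ℝ)⁻¹ * √(2 * Real.sin θ ^ 2) + (n : ℝ)⁻¹ ^ 2 := by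
    rw [oscScale, abs_of_nonneg ht0, htθ]
  have hsq : √(2 * Real.sin θ ^ 2) = √2 * Real.sin θ := by
    rw [Real.sqrt_mul (by norm_num), Real.sqrt_sq (by linarith)]
  have hr2 : √2 ≤ 3 / 2 := Real.sqrt_le_iff.2 ⟨by norm_num, by norm_num⟩
  have hr1 : 1 ≤ √2 := Real.le_sqrt_of_sq_le (by norm_num)
  set D := oscScale (n : ℝ)⁻¹ t with hD
  have hD0 : 0 < D := oscScale_pos (by positivity) t
  have hDeq : D = (n : ℝ)⁻¹ * (√2 * Real.sin θ + (n : ℝ)⁻¹) := by rw [hsc, hsq]; ring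
  have hq0 : 0 ≤ √2 * Real.sin θ := mul_nonneg (by positivity) (by linarith)
  have hq1 : √2 * Real.sin θ ≤ 3 / 2 * θ := by nlinarith
  have hq2 : θ / 2 ≤ √2 * Real.sin θ := by nlinarith
  have hni : 0 < (n : ℝ)⁻¹ := by positivity
  rw [hval]
  -- the scale is comparable to `θ / n` for `θ ≥ 1 / n`, and to `1 / n ^ 2` otherwise
  rcases le_total (n : ℝ)⁻¹ θ with hcase | hcase
  · have hb := h1 n θ hn hlarge hcase hθ1
    have hθpos : 0 < θ := lt_of_lt_of_le (by positivity) hcase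
    have hcmp : ((n : ℝ)⁻¹ * θ) ^ (-α - 1 / 2) ≤ 3 ^ |-α - 1 / 2| * D ^ (-α - 1 / 2) := by
      refine rpow_le_of_comparable (by positivity) hD0 (by norm_num) ?_ ?_ _
      · rw [hDeq]; nlinarith
      · rw [hDeq]; nlinarith
    have hid : (n : ℝ) ^ (-(1 / 2 : ℝ)) * θ ^ (-α - 1 / 2)
        = (n : ℝ) ^ (-α - 1) * ((n : ℝ)⁻¹ * θ) ^ (-α - 1 / 2) := by
      rw [Real.mul_rpow hni.le hθ0, Real.inv_rpow hn0.le, ← Real.rpow_neg hn0.le, ← mul_assoc,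
        ← Real.rpow_add hn0]
      congr 2; ring
    rw [hid] at hb
    calc _ ≤ _ := hb
      _ ≤ C1 * ((n : ℝ) ^ (-α - 1) * (3 ^ |-α - 1 / 2| * D ^ (-α - 1 / 2))) := by gcongr
      _ ≤ (C1 + C2) * ((n : ℝ) ^ (-α - 1) * (3 ^ |-α - 1 / 2| * D ^ (-α - 1 / 2))) := by
        gcongr; linarith
      _ = _ := by ring
  · have hv : |-(Real.sin θ) ^ 2| ≤ ((n : ℝ) ^ 2)⁻¹ := by
      rw [abs_neg, abs_of_nonneg (by positivity), ← inv_pow]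
      exact pow_le_pow_left₀ (by linarith) (hsin1.trans hcase) 2
    have hb := h2 n _ (by omega) hv
    have hcmp : ((n : ℝ)⁻¹ * (n : ℝ)⁻¹) ^ (-α - 1 / 2) ≤ 3 ^ |-α - 1 / 2| * D ^ (-α - 1 / 2) := by
      refine rpow_le_of_comparable (by positivity) hD0 (by norm_num) ?_ ?_ _
      · rw [hDeq]; nlinarith
      · rw [hDeq]; nlinarith
    have hid : (n : ℝ) ^ α = (n : ℝ) ^ (-α - 1) * ((n : ℝ)⁻¹ * (n : ℝ)⁻¹) ^ (-α - 1 / 2) := by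
      rw [Real.mul_rpow hni.le hni.le, Real.inv_rpow hn0.le, ← Real.rpow_neg hn0.le,
        ← Real.rpow_add hn0, ← Real.rpow_add hn0]
      congr 1; ring
    rw [hid] at hb
    calc _ ≤ _ := hb
      _ ≤ C2 * ((n : ℝ) ^ (-α - 1) * (3 ^ |-α - 1 / 2| * D ^ (-α - 1 / 2))) := by gcongr
      _ ≤ (C1 + C2) * ((n : ℝ) ^ (-α - 1) * (3 ^ |-α - 1 / 2| * D ^ (-α - 1 / 2))) := by
        gcongr; linarith
      _ = _ := by ring

/-- Szegő's bound for Jacobi polynomials, for arbitrary real parameters `β ≤ α`. -/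
lemma exists_jacobiPoly_bound {α β : ℝ} (hαβ : β ≤ α) : ∃ C : ℝ, 0 < C ∧ ∀ (n : ℕ) (t : ℝ), 2 ≤ n →
    2 * |α + β + 1| ≤ n → |t| ≤ 1 → |(jacobiPoly n α β).eval t|
      ≤ C * ((n : ℝ) ^ (-α - 1) * oscScale (n : ℝ)⁻¹ t ^ (-α - 1 / 2)) := by
  obtain ⟨C1, hC1, h1⟩ := exists_jacobiPoly_bound_nonneg α β
  obtain ⟨C2, hC2, h2⟩ := exists_jacobiPoly_bound_nonneg β α
  refine ⟨C1 + C2 * 2 ^ (α - β), by positivity, fun n t hn hlarge ht => ?_⟩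
  have hn0 : (0 : ℝ) < n := by exact_mod_cast (by omega : 0 < n)
  have hn1 : (n : ℝ)⁻¹ ≤ 1 := inv_le_one_of_one_le₀ (by exact_mod_cast (by omega : 1 ≤ n))
  have hD0 : 0 < oscScale (n : ℝ)⁻¹ t := oscScale_pos (by positivity) t
  obtain ⟨hl, hr⟩ := abs_le.1 ht
  rcases le_total 0 t with h0 | h0
  · refine (h1 n t hn hlarge h0 hr).trans ?_
    gcongr
    have : 0 ≤ C2 * 2 ^ (α - β) := by positivity
    linarith
  · have h3 := h2 n (-t) hn (by rwa [add_comm β α]) (by linarith) (by linarith)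
    have h4 : oscScale (n : ℝ)⁻¹ (-t) = oscScale (n : ℝ)⁻¹ t := by rw [oscScale, oscScale, abs_neg]
    have h5 : |(jacobiPoly n α β).eval t| = |(jacobiPoly n β α).eval (-t)| := by
      rw [jacobiPoly_eval_neg, abs_mul, abs_pow, abs_neg, abs_one, one_pow, one_mul]
    rw [h5]
    rw [h4] at h3
    set D := oscScale (n : ℝ)⁻¹ t with hD
    -- passing from exponent `β` to `α` costs `(n D) ^ (α - β)`, and `n D ≤ 2`
    have h6 : n * D ≤ 2 := by
      have : √(1 - |t|) ≤ 1 := Real.sqrt_le_one.2 (by linarith [abs_nonneg t])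
      have e : n * D = √(1 - |t|) + (n : ℝ)⁻¹ := by
        rw [hD, oscScale]; field_simp
      rw [e]; linarith
    have h7 : (n : ℝ) ^ (-β - 1) * D ^ (-β - 1 / 2)
        = (n * D) ^ (α - β) * ((n : ℝ) ^ (-α - 1) * D ^ (-α - 1 / 2)) := by
      rw [Real.mul_rpow hn0.le hD0.le, show -β - 1 = (α - β) + (-α - 1) by ring,
        show -β - 1 / 2 = (α - β) + (-α - 1 / 2) by ring, Real.rpow_add hn0, Real.rpow_add hD0]
      ring
    have h8 : (n * D) ^ (α - β) ≤ 2 ^ (α - β) :=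
      Real.rpow_le_rpow (by positivity) h6 (by linarith)
    rw [h7] at h3
    calc _ ≤ _ := h3
      _ ≤ C2 * (2 ^ (α - β) * ((n : ℝ) ^ (-α - 1) * D ^ (-α - 1 / 2))) := by gcongr
      _ ≤ (C1 + C2 * 2 ^ (α - β)) * ((n : ℝ) ^ (-α - 1) * D ^ (-α - 1 / 2)) := by
        have : 0 ≤ C1 * ((n : ℝ) ^ (-α - 1) * D ^ (-α - 1 / 2)) := by positivity
        linarith

/-! ### Chains of primitives -/

/-- A sequence of continuous functions in which each of `f 1, …, f L` is a primitive of its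
predecessor. Nothing but continuity is asked of the later members. -/
structure IsPrimitiveChain (L : ℕ) (f : ℕ → ℝ → ℝ) : Prop where
  continuous : ∀ ℓ, Continuous (f ℓ)
  hasDerivAt : ∀ ℓ < L, ∀ z, HasDerivAt (f (ℓ + 1)) (f ℓ z) z

/-- Iterated primitives, each vanishing at `0`. -/
noncomputable def iterPrimitive (g : ℝ → ℝ) : ℕ → ℝ → ℝ
  | 0 => g
  | ℓ + 1 => fun z => ∫ t in (0 : ℝ)..z, iterPrimitive g ℓ t

lemma continuous_iterPrimitive {g : ℝ → ℝ} (hg : Continuous g) (ℓ : ℕ) :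
    Continuous (iterPrimitive g ℓ) := by
  induction ℓ with
  | zero => exact hg
  | succ ℓ ih => exact intervalIntegral.continuous_primitive (fun a b => ih.intervalIntegrable a b) 0

lemma isPrimitiveChain_iterPrimitive {g : ℝ → ℝ} (hg : Continuous g) (L : ℕ) :
    IsPrimitiveChain L (iterPrimitive g) where
  continuous := continuous_iterPrimitive hg
  hasDerivAt ℓ _ z := by
    have h := continuous_iterPrimitive hg ℓ
    exact intervalIntegral.integral_hasDerivAt_right (h.intervalIntegrable _ _)
      (h.stronglyMeasurableAtFilter _ _) h.continuousAt

lemma continuous_oscScale (ε : ℝ) : Continuous (oscScale ε) := by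
  unfold oscScale; fun_prop

/-- The chain of normalized Jacobi polynomials `P_{n+ℓ}^{(α-ℓ,β-ℓ)}`, each a primitive of the
preceding one as long as `n + α + β - ℓ` does not vanish. -/
noncomputable def jacobiPrimitive (n : ℕ) (α β : ℝ) (ℓ : ℕ) (z : ℝ) : ℝ :=
  (∏ i ∈ Finset.range ℓ, 2 / (n + α + β - i)) * (jacobiPoly (n + ℓ) (α - ℓ) (β - ℓ)).eval z

lemma isPrimitiveChain_jacobiPrimitive {n L : ℕ} {α β : ℝ} (h : L + |α + β| < n) :
    IsPrimitiveChain L (jacobiPrimitive n α β) where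
  continuous ℓ := by unfold jacobiPrimitive; fun_prop
  hasDerivAt ℓ hℓ z := by
    have h1 := (hasDerivAt_jacobiPoly_succ (n + ℓ) (α - (ℓ + 1 : ℕ)) (β - (ℓ + 1 : ℕ)) z).const_mul
      (∏ i ∈ Finset.range (ℓ + 1), 2 / (n + α + β - i))
    refine h1.congr_deriv ?_
    have hℓ' : (ℓ : ℝ) < L := by exact_mod_cast hℓ
    have hne : (n : ℝ) + α + β - ℓ ≠ 0 := by
      have := neg_abs_le (α + β)
      have : 0 < (n : ℝ) + α + β - ℓ := by linarith
      exact this.ne'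
    rw [Finset.prod_range_succ, jacobiPrimitive]
    have e1 : α - ((ℓ + 1 : ℕ) : ℝ) + 1 = α - ℓ := by push_cast; ring
    have e2 : β - ((ℓ + 1 : ℕ) : ℝ) + 1 = β - ℓ := by push_cast; ring
    rw [e1, e2]
    push_cast
    field_simp
    ring

lemma exists_jacobiPrimitive_bound {α β : ℝ} (hαβ : β ≤ α) (L ℓ : ℕ) (hℓ : ℓ ≤ L) :
    ∃ C : ℝ, 0 < C ∧ ∀ (n : ℕ) (z : ℝ), 4 * (L + |α + β| + 1) ≤ n → |z| ≤ 1 →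
      |jacobiPrimitive n α β ℓ z|
        ≤ C * ((n : ℝ) ^ (-α - 1) * oscScale (n : ℝ)⁻¹ z ^ (-α - 1 / 2) * oscScale (n : ℝ)⁻¹ z ^ ℓ) := by
  obtain ⟨C, hC, h⟩ := exists_jacobiPoly_bound (α := α - ℓ) (β := β - ℓ) (by linarith)
  set b : ℝ := 1 + ℓ with hb
  have hb1 : 1 ≤ b := by rw [hb]; linarith [(Nat.cast_nonneg ℓ : (0 : ℝ) ≤ ℓ)]
  set p := -(α - ℓ) - 1 with hp
  set q := -(α - ℓ) - 1 / 2 with hq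
  refine ⟨4 ^ ℓ * (C * (b ^ |p| * (b ^ 2) ^ |q|)), by positivity, fun n z hn hz => ?_⟩
  have hℓL : (ℓ : ℝ) ≤ L := by exact_mod_cast hℓ
  have hℓ0 : (0 : ℝ) ≤ ℓ := Nat.cast_nonneg ℓ
  have habs := abs_nonneg (α + β)
  have hn2 : (2 : ℝ) ≤ n := by linarith
  have hn0 : (0 : ℝ) < n := by linarith
  have hn2' : 2 ≤ n := by exact_mod_cast hn2
  set N := n + ℓ with hN
  have hNc : (N : ℝ) = n + ℓ := by rw [hN]; push_cast; ring
  have hN0 : (0 : ℝ) < N := by rw [hNc]; linarith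
  have h1 := h N z (by omega) (by
    have : |α - ℓ + (β - ℓ) + 1| ≤ |α + β| + 2 * ℓ + 1 := by
      rw [abs_le]; constructor <;> linarith [neg_abs_le (α + β), le_abs_self (α + β)]
    rw [hNc]
    linarith) hz
  have hcN : ∀ s : ℝ, (N : ℝ) ^ s ≤ b ^ |s| * (n : ℝ) ^ s := fun s =>
    rpow_le_of_comparable hN0 hn0 hb1 (by rw [hNc, hb]; nlinarith) (by rw [hNc]; nlinarith) s
  set D := oscScale (n : ℝ)⁻¹ z with hD
  have hD0 : 0 < D := oscScale_pos (by positivity) z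
  have hD' : 0 < oscScale (N : ℝ)⁻¹ z := oscScale_pos (by positivity) z
  have hinv1 : (N : ℝ)⁻¹ ≤ (n : ℝ)⁻¹ := inv_anti₀ hn0 (by rw [hNc]; linarith)
  have hinv2 : (n : ℝ)⁻¹ ≤ b * (N : ℝ)⁻¹ := by
    rw [← div_eq_mul_inv, le_div_iff₀ hN0, ← div_eq_inv_mul, div_le_iff₀ hn0, hNc, hb]; nlinarith
  have hcD : oscScale (N : ℝ)⁻¹ z ^ q ≤ (b ^ 2) ^ |q| * D ^ q := by
    refine rpow_le_of_comparable hD' hD0 (by nlinarith) ?_ ?_ q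
    · have h2 : oscScale (N : ℝ)⁻¹ z ≤ D := by
        rw [hD, oscScale, oscScale]; gcongr
      exact h2.trans (le_mul_of_one_le_left hD0.le (one_le_pow₀ hb1))
    · rw [hD, oscScale, oscScale, mul_add]
      have hs := Real.sqrt_nonneg (1 - |z|)
      have h3 : (n : ℝ)⁻¹ * √(1 - |z|) ≤ b ^ 2 * ((N : ℝ)⁻¹ * √(1 - |z|)) := by
        rw [← mul_assoc]
        refine mul_le_mul_of_nonneg_right (hinv2.trans ?_) hs
        refine mul_le_mul_of_nonneg_right ?_ (by positivity)
        nlinarith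
      have h4 : (n : ℝ)⁻¹ ^ 2 ≤ b ^ 2 * (N : ℝ)⁻¹ ^ 2 := by
        rw [← mul_pow]; exact pow_le_pow_left₀ (by positivity) hinv2 2
      linarith
  have hprod : |∏ i ∈ Finset.range ℓ, 2 / ((n : ℝ) + α + β - i)| ≤ (4 / n) ^ ℓ := by
    rw [Finset.abs_prod]
    refine (Finset.prod_le_prod (fun _ _ => abs_nonneg _) (g := fun _ => 4 / (n : ℝ)) ?_).trans
      (by rw [Finset.prod_const, Finset.card_range])
    intro i hi
    have hi' : (i : ℝ) ≤ L := by
      have : i < ℓ := by simpa using hi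
      exact_mod_cast (by omega : i ≤ L)
    have hpos : (n : ℝ) / 2 ≤ n + α + β - i := by
      have := neg_abs_le (α + β)
      linarith
    rw [abs_of_pos (div_pos two_pos (by linarith)), div_le_div_iff₀ (by linarith) hn0]
    linarith
  rw [jacobiPrimitive, abs_mul]
  have hp' : (n : ℝ) ^ p = (n : ℝ) ^ (-α - 1) * (n : ℝ) ^ ℓ := by
    rw [hp, show -(α - ℓ) - 1 = (-α - 1) + ℓ by ring, Real.rpow_add hn0, Real.rpow_natCast]
  have hq' : D ^ q = D ^ (-α - 1 / 2) * D ^ ℓ := by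
    rw [hq, show -(α - ℓ) - 1 / 2 = (-α - 1 / 2) + ℓ by ring, Real.rpow_add hD0, Real.rpow_natCast]
  calc _ ≤ (4 / n) ^ ℓ * (C * ((b ^ |p| * (n : ℝ) ^ p) * ((b ^ 2) ^ |q| * D ^ q))) := by
        refine mul_le_mul hprod (h1.trans ?_) (abs_nonneg _) (by positivity)
        gcongr
        exact hcN p
    _ = _ := by
        rw [hp', hq', div_pow]
        field_simp

/-- Every Jacobi polynomial starts a chain of primitives in which each integration gains a factor
`oscScale`, with constants that do not depend on the degree. -/
lemma exists_jacobi_chain {α β : ℝ} (hαβ : β ≤ α) (L : ℕ) :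
    ∃ A : ℝ, 0 ≤ A ∧ ∀ n : ℕ, 1 ≤ n → ∃ f : ℕ → ℝ → ℝ, (∀ z, f 0 z = (jacobiPoly n α β).eval z) ∧
      IsPrimitiveChain L f ∧ ∀ ℓ ≤ L, ∀ z, |z| ≤ 1 → |f ℓ z|
        ≤ A * ((n : ℝ) ^ (-α - 1) * oscScale (n : ℝ)⁻¹ z ^ (-α - 1 / 2) * oscScale (n : ℝ)⁻¹ z ^ ℓ) := by
  -- for large degrees the normalized Jacobi polynomials form the chain
  have hlarge : ∀ ℓ : ℕ, ∃ C : ℝ, 0 ≤ C ∧ (ℓ ≤ L → ∀ (n : ℕ) (z : ℝ),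
      4 * (L + |α + β| + 1) ≤ n → |z| ≤ 1 → |jacobiPrimitive n α β ℓ z|
        ≤ C * ((n : ℝ) ^ (-α - 1) * oscScale (n : ℝ)⁻¹ z ^ (-α - 1 / 2) * oscScale (n : ℝ)⁻¹ z ^ ℓ)) := by
    intro ℓ
    by_cases hℓ : ℓ ≤ L
    · obtain ⟨C, hC, h⟩ := exists_jacobiPrimitive_bound hαβ L ℓ hℓ
      exact ⟨C, hC.le, fun _ => h⟩
    · exact ⟨0, le_rfl, fun h => absurd h hℓ⟩
  -- for a fixed degree, any chain of primitives is bounded by compactness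
  have hsmall : ∀ n ℓ : ℕ, ∃ C : ℝ, 0 ≤ C ∧ (1 ≤ n → ∀ z, |z| ≤ 1 →
      |iterPrimitive (fun z => (jacobiPoly n α β).eval z) ℓ z|
        ≤ C * ((n : ℝ) ^ (-α - 1) * oscScale (n : ℝ)⁻¹ z ^ (-α - 1 / 2) * oscScale (n : ℝ)⁻¹ z ^ ℓ)) := by
    intro n ℓ
    by_cases hn : 1 ≤ n
    · have hn0 : (0 : ℝ) < n := by exact_mod_cast hn
      have hD0 : ∀ z, 0 < oscScale (n : ℝ)⁻¹ z := fun z => oscScale_pos (by positivity) z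
      set w : ℝ → ℝ := fun z =>
        (n : ℝ) ^ (-α - 1) * oscScale (n : ℝ)⁻¹ z ^ (-α - 1 / 2) * oscScale (n : ℝ)⁻¹ z ^ ℓ with hw
      have hw0 : ∀ z, 0 < w z := fun z => by have := hD0 z; simp only [hw]; positivity
      have hwc : Continuous w := by
        have h1 := continuous_oscScale (n : ℝ)⁻¹
        exact (continuous_const.mul (h1.rpow_const fun z => Or.inl (hD0 z).ne')).mul (h1.pow ℓ)
      have hfc := continuous_iterPrimitive
        (g := fun z => (jacobiPoly n α β).eval z) (by fun_prop) ℓ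
      obtain ⟨C, hC⟩ := (isCompact_Icc (a := (-1 : ℝ)) (b := 1)).exists_bound_of_continuousOn
        (hfc.div hwc fun z => (hw0 z).ne').continuousOn
      refine ⟨max C 0, le_max_right _ _, fun _ z hz => ?_⟩
      have h2 := (hC z (abs_le.1 hz)).trans (le_max_left C 0)
      rwa [Pi.div_apply, norm_div, Real.norm_eq_abs, Real.norm_eq_abs, abs_of_pos (hw0 z), div_le_iff₀ (hw0 z)] at h2
    · exact ⟨0, le_rfl, fun h => absurd h hn⟩
  choose C1 hC1 h1 using hlarge
  choose C2 hC2 h2 using hsmall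
  obtain ⟨N, hN⟩ := exists_nat_ge (4 * (L + |α + β| + 1))
  refine ⟨∑ ℓ ∈ Finset.range (L + 1), C1 ℓ
      + ∑ n ∈ Finset.range N, ∑ ℓ ∈ Finset.range (L + 1), C2 n ℓ,
    add_nonneg (Finset.sum_nonneg fun _ _ => hC1 _)
      (Finset.sum_nonneg fun _ _ => Finset.sum_nonneg fun _ _ => hC2 _ _), fun n hn => ?_⟩
  have hn0 : (0 : ℝ) < n := by exact_mod_cast hn
  have hw0 : ∀ (ℓ : ℕ) z, 0 ≤ (n : ℝ) ^ (-α - 1) * oscScale (n : ℝ)⁻¹ z ^ (-α - 1 / 2)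
      * oscScale (n : ℝ)⁻¹ z ^ ℓ := fun ℓ z => by
    have := oscScale_pos (inv_pos.2 hn0) z
    positivity
  by_cases hnN : N ≤ n
  · have hnN' : 4 * (L + |α + β| + 1) ≤ (n : ℝ) := hN.trans (by exact_mod_cast hnN)
    refine ⟨jacobiPrimitive n α β, fun z => by simp [jacobiPrimitive],
      isPrimitiveChain_jacobiPrimitive ?_, fun ℓ hℓ z hz => ?_⟩
    · have : (0 : ℝ) ≤ L := Nat.cast_nonneg L
      linarith [abs_nonneg (α + β)]
    · refine (h1 ℓ hℓ n z hnN' hz).trans (mul_le_mul_of_nonneg_right ?_ (hw0 ℓ z))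
      have h3 := Finset.single_le_sum (f := C1) (fun i _ => hC1 i)
        (Finset.mem_range.2 (Nat.lt_succ_of_le hℓ))
      have h4 : 0 ≤ ∑ n ∈ Finset.range N, ∑ ℓ ∈ Finset.range (L + 1), C2 n ℓ :=
        Finset.sum_nonneg fun _ _ => Finset.sum_nonneg fun _ _ => hC2 _ _
      linarith
  · refine ⟨iterPrimitive fun z => (jacobiPoly n α β).eval z, fun z => rfl,
      isPrimitiveChain_iterPrimitive (by fun_prop) L, fun ℓ hℓ z hz => ?_⟩
    refine (h2 n ℓ hn z hz).trans (mul_le_mul_of_nonneg_right ?_ (hw0 ℓ z))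
    have h3 := Finset.single_le_sum (f := C2 n) (fun i _ => hC2 n i)
      (Finset.mem_range.2 (Nat.lt_succ_of_le hℓ))
    have h4 := Finset.single_le_sum (f := fun n => ∑ ℓ ∈ Finset.range (L + 1), C2 n ℓ)
      (fun i _ => Finset.sum_nonneg fun j _ => hC2 i j) (Finset.mem_range.2 (not_le.1 hnN))
    have h5 : 0 ≤ ∑ ℓ ∈ Finset.range (L + 1), C1 ℓ := Finset.sum_nonneg fun _ _ => hC1 _
    linarith

/-! ### Integration against an endpoint singularity -/

/-- `h 0` is a weight on `(0, ∞)` with an endpoint singularity `s ^ (κ - 1)` at `0`; `h k` is its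
`k`-th derivative, of size at most `H k * s ^ (κ - 1 - k)`; and all vanish beyond `5 / 4`. -/
structure IsEndpointWeight (κ : ℝ) (h : ℕ → ℝ → ℝ) (H : ℕ → ℝ) : Prop where
  hasDerivAt : ∀ k s, 0 < s → HasDerivAt (h k) (h (k + 1) s) s
  bound : ∀ k s, 0 < s → |h k s| ≤ H k * s ^ (κ - 1 - k)
  eq_zero : ∀ k s, 5 / 4 < s → h k s = 0
  nonneg : ∀ k, 0 ≤ H k

namespace IsEndpointWeight

variable {κ : ℝ} {h : ℕ → ℝ → ℝ} {H : ℕ → ℝ}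

lemma continuousOn (hh : IsEndpointWeight κ h H) (k : ℕ) : ContinuousOn (h k) (Set.Ioi 0) :=
  fun s hs => (hh.hasDerivAt k s hs).continuousAt.continuousWithinAt

lemma intervalIntegrable_rpow (hκ : 0 < κ) (a b : ℝ) :
    IntervalIntegrable (fun s : ℝ => s ^ (κ - 1)) MeasureTheory.volume a b :=
  intervalIntegral.intervalIntegrable_rpow' (by linarith)

lemma intervalIntegrable (hh : IsEndpointWeight κ h H) (hκ : 0 < κ) {a b : ℝ} (ha : 0 ≤ a)
    (hb : 0 ≤ b) : IntervalIntegrable (h 0) MeasureTheory.volume a b := by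
  have hsub : Set.uIoc a b ⊆ Set.Ioi 0 := fun x hx => lt_of_le_of_lt (le_min ha hb) hx.1
  refine ((intervalIntegrable_rpow hκ a b).const_mul (H 0)).mono_fun ?_ ?_
  · exact ((hh.continuousOn 0).mono hsub).aestronglyMeasurable measurableSet_uIoc
  · refine (MeasureTheory.ae_restrict_iff' measurableSet_uIoc).2 (Filter.Eventually.of_forall ?_)
    intro s hs
    have hs0 : 0 < s := hsub hs
    have h1 := hh.bound 0 s hs0
    have := hh.nonneg 0
    change |h 0 s| ≤ |H 0 * s ^ (κ - 1)|
    rw [abs_of_nonneg (a := H 0 * s ^ (κ - 1)) (by positivity)]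
    simpa using h1

/-- Repeated integration by parts on `[B, 2]` against a chain `F` with `F (i + 1)' = -a F i`. -/
lemma abs_integral_le_sum (hh : IsEndpointWeight κ h H) {a B : ℝ} (ha : a ≠ 0) (hB : 0 < B)
    (hB2 : B ≤ 2) {F : ℕ → ℝ → ℝ} (hF : ∀ i, Continuous (F i)) (ℓ K : ℕ)
    (hd : ∀ i < ℓ + K, ∀ s, HasDerivAt (F (i + 1)) (-a * F i s) s) :
    |∫ s in B..2, F ℓ s * h 0 s| ≤
      ∑ k ∈ Finset.range K, |a|⁻¹ ^ (k + 1) * (|F (ℓ + k + 1) B| * |h k B|)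
        + |a|⁻¹ ^ K * |∫ s in B..2, F (ℓ + K) s * h K s| := by
  induction K with
  | zero => simp
  | succ K ih =>
    have h1 := ih fun i hi => hd i (by omega)
    have hsub : Set.uIcc B 2 ⊆ Set.Ioi 0 := by
      rw [Set.uIcc_of_le hB2]; exact fun x hx => lt_of_lt_of_le hB hx.1
    have hibp := intervalIntegral.integral_mul_deriv_eq_deriv_mul (a := B) (b := 2)
      (u := h K) (u' := h (K + 1)) (v := F (ℓ + K + 1)) (v' := fun s => -a * F (ℓ + K) s)
      (fun s hs => hh.hasDerivAt K s (hsub hs)) (fun s _ => hd (ℓ + K) (by omega) s)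
      ((hh.continuousOn (K + 1)).mono hsub).intervalIntegrable
      ((continuous_const.mul (hF _)).intervalIntegrable _ _)
    rw [hh.eq_zero K 2 (by norm_num), zero_mul, zero_sub] at hibp
    have e1 : ∫ s in B..2, h K s * (-a * F (ℓ + K) s) = -a * ∫ s in B..2, F (ℓ + K) s * h K s := by
      rw [← intervalIntegral.integral_const_mul]
      congr 1; ext s; ring
    have e2 : ∫ s in B..2, h (K + 1) s * F (ℓ + K + 1) s
        = ∫ s in B..2, F (ℓ + K + 1) s * h (K + 1) s := by
      congr 1; ext s; ring
    rw [e1, e2] at hibp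
    have ha' : 0 < |a| := abs_pos.2 ha
    have h2 : |∫ s in B..2, F (ℓ + K) s * h K s| ≤ |a|⁻¹ * (|F (ℓ + K + 1) B| * |h K B|
        + |∫ s in B..2, F (ℓ + K + 1) s * h (K + 1) s|) := by
      rw [← div_eq_inv_mul, le_div_iff₀ ha', mul_comm, ← abs_mul,
        show a * ∫ s in B..2, F (ℓ + K) s * h K s
          = h K B * F (ℓ + K + 1) B + ∫ s in B..2, F (ℓ + K + 1) s * h (K + 1) s by linarith]
      refine (abs_add_le _ _).trans ?_
      rw [abs_mul, mul_comm |h K B|]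
    rw [Finset.sum_range_succ, ← add_assoc ℓ K 1]
    calc _ ≤ _ := h1
      _ ≤ ∑ k ∈ Finset.range K, |a|⁻¹ ^ (k + 1) * (|F (ℓ + k + 1) B| * |h k B|)
          + |a|⁻¹ ^ K * (|a|⁻¹ * (|F (ℓ + K + 1) B| * |h K B|
            + |∫ s in B..2, F (ℓ + K + 1) s * h (K + 1) s|)) := by gcongr
      _ = _ := by ring

/-- Where `F` is bounded by `M`, only the mass `∫ s ^ (κ - 1)` of the weight matters. -/
lemma abs_integral_le_of_le (hh : IsEndpointWeight κ h H) (hκ : 0 < κ) {F : ℝ → ℝ} {M b : ℝ}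
    (hb : 0 ≤ b) (hF : ∀ s, 0 < s → s ≤ b → s ≤ 5 / 4 → |F s| ≤ M) (hM : 0 ≤ M) :
    |∫ s in (0 : ℝ)..b, F s * h 0 s| ≤ M * (H 0 * (b ^ κ / κ)) := by
  have h1 : ‖∫ s in (0 : ℝ)..b, F s * h 0 s‖ ≤ ∫ s in (0 : ℝ)..b, M * (H 0 * s ^ (κ - 1)) := by
    refine intervalIntegral.norm_integral_le_of_norm_le hb (Filter.Eventually.of_forall ?_)
      (((intervalIntegrable_rpow hκ 0 b).const_mul (H 0)).const_mul M)
    intro s hs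
    rw [norm_mul, Real.norm_eq_abs, Real.norm_eq_abs]
    have h2 := hh.bound 0 s hs.1
    rw [Nat.cast_zero, sub_zero] at h2
    have h3 := hh.nonneg 0
    have hs0 := hs.1
    rcases le_or_gt s (5 / 4) with h4 | h4
    · exact mul_le_mul (hF s hs.1 hs.2 h4) h2 (abs_nonneg _) hM
    · rw [hh.eq_zero 0 s h4]; simp only [abs_zero, mul_zero]; positivity
  rw [intervalIntegral.integral_const_mul, intervalIntegral.integral_const_mul,
    integral_rpow (Or.inl (by linarith)), sub_add_cancel, Real.zero_rpow hκ.ne', sub_zero] at h1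
  exact h1

/-- The contribution of one endpoint. At distance `s` from the endpoint the oscillation length of
`F` is at most `D + √(D |a| s)`, and each integration by parts trades a factor of that length
against `|a| s`. So only `s ≲ D / |a|` contributes, a set of weight `(D / |a|) ^ κ`. -/
lemma exists_abs_integral_le (hκ : 0 < κ) (H : ℕ → ℝ) (ℓ K : ℕ) (hK : ℓ + 2 * κ < K) :
    ∃ C : ℝ, 0 ≤ C ∧ ∀ h : ℕ → ℝ → ℝ, IsEndpointWeight κ h H →
      ∀ (a D G : ℝ) (F : ℕ → ℝ → ℝ), a ≠ 0 → 0 < D → 0 ≤ G → (∀ i, Continuous (F i)) →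
      (∀ i < ℓ + K, ∀ s, HasDerivAt (F (i + 1)) (-a * F i s) s) →
      (∀ i ≤ ℓ + K, ∀ s, 0 < s → s ≤ 5 / 4 → |F i s| ≤ G * (D + √(D * (|a| * s))) ^ i) →
      |∫ s in (0 : ℝ)..2, F ℓ s * h 0 s| ≤ C * (G * D ^ ℓ * (D / (|a| + D)) ^ κ) := by
  -- after `K` integrations by parts the integrand decays like `s ^ (e - 1)`, and `e < 0`
  set e : ℝ := κ - (K - ℓ) / 2 with he
  have he0 : e < 0 := by rw [he]; linarith
  set C1 : ℝ := 3 ^ ℓ * |H 0| * 2 ^ κ / κ * 2 ^ κ with hC1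
  set C2 : ℝ := 2 ^ κ * (2 ^ ℓ * |H 0| / κ + ∑ k ∈ Finset.range K, 2 ^ (ℓ + k + 1) * |H k|
    + 2 ^ (ℓ + K) * |H K| / (-e)) with hC2
  have hC10 : 0 ≤ C1 := by positivity
  have hC20 : 0 ≤ C2 := by
    have : 0 < -e := by linarith
    positivity
  refine ⟨C1 + C2, by positivity, ?_⟩
  intro h hh a D G F ha hD hG hF hd hbd
  have ha' : 0 < |a| := abs_pos.2 ha
  have hr0 : 0 < D / (|a| + D) := by positivity
  have hHabs : ∀ k, |H k| = H k := fun k => abs_of_nonneg (hh.nonneg k)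
  have hscale : 0 ≤ G * D ^ ℓ * (D / (|a| + D)) ^ κ := by positivity
  -- for `|a| ≤ D` there is no oscillation to exploit, and none is needed
  rcases le_or_gt |a| D with hcase | hcase
  · have h1 : |∫ s in (0 : ℝ)..2, F ℓ s * h 0 s| ≤ G * (3 * D) ^ ℓ * (H 0 * (2 ^ κ / κ)) := by
      refine hh.abs_integral_le_of_le hκ (by norm_num) (fun s hs _ hs2 => ?_) (by positivity)
      refine (hbd ℓ (by omega) s hs hs2).trans ?_
      have : √(D * (|a| * s)) ≤ 2 * D := by
        refine Real.sqrt_le_iff.2 ⟨by positivity, ?_⟩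
        have : |a| * s ≤ D * 2 := by nlinarith
        nlinarith
      gcongr
      linarith
    have h2 : 1 ≤ 2 ^ κ * (D / (|a| + D)) ^ κ := by
      rw [← Real.mul_rpow (by norm_num) hr0.le]
      refine Real.one_le_rpow ?_ hκ.le
      rw [← mul_div_assoc, one_le_div (by positivity)]; linarith
    calc _ ≤ _ := h1
      _ = (3 ^ ℓ * |H 0| * 2 ^ κ / κ) * (G * D ^ ℓ) * 1 := by rw [hHabs, mul_pow]; ring
      _ ≤ (3 ^ ℓ * |H 0| * 2 ^ κ / κ) * (G * D ^ ℓ) * (2 ^ κ * (D / (|a| + D)) ^ κ) := by gcongr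
      _ = C1 * (G * D ^ ℓ * (D / (|a| + D)) ^ κ) := by rw [hC1]; ring
      _ ≤ _ := by
        have := mul_nonneg hC20 hscale
        linarith
  · set B := D / |a| with hB
    have hB0 : 0 < B := by positivity
    have hB1 : B < 1 := (div_lt_one ha').2 hcase
    have hDB : D = |a| * B := by rw [hB]; field_simp
    have hBκ : B ^ κ ≤ 2 ^ κ * (D / (|a| + D)) ^ κ := by
      rw [← Real.mul_rpow (by norm_num) hr0.le]
      refine Real.rpow_le_rpow hB0.le ?_ hκ.le
      rw [hB, ← mul_div_assoc, div_le_div_iff₀ ha' (by positivity)]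
      nlinarith
    -- below the cutoff `B`, the scale is comparable to `D`
    have hlow : ∀ i ≤ ℓ + K, ∀ s, 0 < s → s ≤ B → |F i s| ≤ G * (2 * D) ^ i := by
      intro i hi s hs hsB
      refine (hbd i hi s hs (by linarith)).trans ?_
      have : √(D * (|a| * s)) ≤ D := by
        refine Real.sqrt_le_iff.2 ⟨hD.le, ?_⟩
        have : |a| * s ≤ D := by rw [hDB]; gcongr
        nlinarith
      gcongr
      linarith
    have hI1 : |∫ s in (0 : ℝ)..B, F ℓ s * h 0 s| ≤ 2 ^ ℓ * |H 0| / κ * (G * D ^ ℓ * B ^ κ) := by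
      refine (hh.abs_integral_le_of_le hκ hB0.le
        (fun s hs hs1 _ => hlow ℓ (by omega) s hs hs1) (by positivity)).trans (le_of_eq ?_)
      rw [hHabs, mul_pow]; ring
    have hterm : ∀ k ∈ Finset.range K, |a|⁻¹ ^ (k + 1) * (|F (ℓ + k + 1) B| * |h k B|)
        ≤ 2 ^ (ℓ + k + 1) * |H k| * (G * D ^ ℓ * B ^ κ) := by
      intro k hk
      have hk' : k < K := by simpa using hk
      have h1 := hlow (ℓ + k + 1) (by omega) B hB0 le_rfl
      have h2 := hh.bound k B hB0
      have hpow : B ^ (κ - 1 - k) = B ^ κ / B ^ (k + 1) := by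
        rw [show κ - 1 - k = κ - ((k + 1 : ℕ) : ℝ) by push_cast; ring,
          Real.rpow_sub hB0, Real.rpow_natCast]
      rw [hpow] at h2
      calc _ ≤ |a|⁻¹ ^ (k + 1) * ((G * (2 * D) ^ (ℓ + k + 1)) * (H k * (B ^ κ / B ^ (k + 1)))) := by
            gcongr
        _ = _ := by
            have hDk : D ^ (ℓ + k + 1) = D ^ ℓ * (|a| ^ (k + 1) * B ^ (k + 1)) := by
              rw [add_assoc, pow_add, ← mul_pow, ← hDB]
            rw [hHabs, mul_pow, hDk, inv_pow]
            field_simp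
    have hrest : |a|⁻¹ ^ K * |∫ s in B..2, F (ℓ + K) s * h K s|
        ≤ 2 ^ (ℓ + K) * |H K| / (-e) * (G * D ^ ℓ * B ^ κ) := by
      set M := |a|⁻¹ ^ K * (G * 2 ^ (ℓ + K) * |a| ^ (ℓ + K) * B ^ (((ℓ + K : ℕ) : ℝ) / 2)) * |H K|
        with hM
      have hint : IntervalIntegrable (fun s : ℝ => s ^ (e - 1)) MeasureTheory.volume B 2 :=
        intervalIntegral.intervalIntegrable_rpow (Or.inr (by
          rw [Set.uIcc_of_le (by linarith)]; exact fun h0 => absurd h0.1 (not_le.2 hB0)))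
      have h1 : |a|⁻¹ ^ K * ‖∫ s in B..2, F (ℓ + K) s * h K s‖ ≤ ∫ s in B..2, M * s ^ (e - 1) := by
        have h2 : ‖∫ s in B..2, F (ℓ + K) s * h K s‖
            ≤ ∫ s in B..2, (|a| ^ K * M) * s ^ (e - 1) := by
          refine intervalIntegral.norm_integral_le_of_norm_le (by linarith)
            (Filter.Eventually.of_forall fun s hs => ?_) (hint.const_mul _)
          have hs0 : 0 < s := hB0.trans hs.1
          rw [norm_mul, Real.norm_eq_abs, Real.norm_eq_abs]
          rcases le_or_gt s (5 / 4) with h4 | h4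
          · have hf := hbd (ℓ + K) le_rfl s hs0 h4
            have hDs : D + √(D * (|a| * s)) ≤ 2 * (|a| * √(B * s)) := by
              have e1 : √(D * (|a| * s)) = |a| * √(B * s) := by
                rw [hDB, show |a| * B * (|a| * s) = |a| ^ 2 * (B * s) by ring,
                  Real.sqrt_mul (by positivity), Real.sqrt_sq ha'.le]
              have e2 : B ≤ √(B * s) := Real.le_sqrt_of_sq_le (by nlinarith [hs.1])
              rw [e1, hDB]
              nlinarith
            have hsq : √(B * s) ^ (ℓ + K)
                = B ^ (((ℓ + K : ℕ) : ℝ) / 2) * s ^ (((ℓ + K : ℕ) : ℝ) / 2) := by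
              rw [Real.sqrt_eq_rpow, ← Real.rpow_natCast, ← Real.rpow_mul (by positivity),
                Real.mul_rpow hB0.le hs0.le]
              congr 2 <;> ring
            have hse : s ^ (((ℓ + K : ℕ) : ℝ) / 2) * s ^ (κ - 1 - K) = s ^ (e - 1) := by
              rw [← Real.rpow_add hs0]; congr 1; rw [he]; push_cast; ring
            calc _ ≤ (G * (2 * (|a| * √(B * s))) ^ (ℓ + K)) * (H K * s ^ (κ - 1 - K)) := by
                  refine mul_le_mul (hf.trans ?_) (hh.bound K s hs0) (abs_nonneg _) (by positivity)
                  gcongr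
              _ = G * 2 ^ (ℓ + K) * |a| ^ (ℓ + K) * B ^ (((ℓ + K : ℕ) : ℝ) / 2) * |H K|
                    * s ^ (e - 1) := by
                  rw [mul_pow, mul_pow, hsq, hHabs, ← hse]; ring
              _ = _ := by
                  rw [hM, inv_pow]; field_simp
          · rw [hh.eq_zero K s h4]; simp only [abs_zero, mul_zero]; positivity
        rw [intervalIntegral.integral_const_mul] at h2 ⊢
        calc _ ≤ |a|⁻¹ ^ K * (|a| ^ K * M * ∫ s in B..2, s ^ (e - 1)) := by gcongr
          _ = _ := by rw [inv_pow]; field_simp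
      rw [intervalIntegral.integral_const_mul, integral_rpow (Or.inr ⟨by linarith, by
          rw [Set.uIcc_of_le (by linarith)]; exact fun h0 => absurd h0.1 (not_le.2 hB0)⟩),
        sub_add_cancel] at h1
      have h3 : ((2 : ℝ) ^ e - B ^ e) / e ≤ B ^ e / (-e) := by
        rw [div_neg, ← neg_div]
        refine div_le_div_of_nonpos_of_le he0.le ?_
        have : (0 : ℝ) < 2 ^ e := by positivity
        linarith
      have hM0 : 0 ≤ M := by positivity
      refine h1.trans ((mul_le_mul_of_nonneg_left h3 hM0).trans (le_of_eq ?_))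
      have hBe : B ^ (((ℓ + K : ℕ) : ℝ) / 2) * B ^ e = B ^ ℓ * B ^ κ := by
        rw [← Real.rpow_add hB0, ← Real.rpow_natCast B ℓ, ← Real.rpow_add hB0]
        congr 1; rw [he]; push_cast; ring
      have hDl : D ^ ℓ = |a| ^ ℓ * B ^ ℓ := by rw [← mul_pow, ← hDB]
      rw [hM, hDl, pow_add |a|]
      have : |a|⁻¹ ^ K * |a| ^ K = 1 := by rw [← mul_pow, inv_mul_cancel₀ ha'.ne', one_pow]
      linear_combination (G * 2 ^ (ℓ + K) * |a| ^ ℓ * |H K| / (-e) * B ^ (((ℓ + K : ℕ) : ℝ) / 2)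
        * B ^ e) * this + (G * 2 ^ (ℓ + K) * |a| ^ ℓ * |H K| / (-e)) * hBe
    have hI2 := hh.abs_integral_le_sum ha hB0 (by linarith) hF ℓ K hd
    have hsplit : ∫ s in (0 : ℝ)..2, F ℓ s * h 0 s
        = (∫ s in (0 : ℝ)..B, F ℓ s * h 0 s) + ∫ s in B..2, F ℓ s * h 0 s :=
      (intervalIntegral.integral_add_adjacent_intervals
        ((hh.intervalIntegrable hκ le_rfl hB0.le).continuousOn_mul (hF ℓ).continuousOn)
        ((hh.intervalIntegrable hκ hB0.le (by norm_num)).continuousOn_mul (hF ℓ).continuousOn)).symm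
    have hsum := Finset.sum_le_sum hterm
    rw [← Finset.sum_mul] at hsum
    rw [hsplit]
    calc _ ≤ _ := abs_add_le _ _
      _ ≤ (2 ^ ℓ * |H 0| / κ + ∑ k ∈ Finset.range K, 2 ^ (ℓ + k + 1) * |H k|
            + 2 ^ (ℓ + K) * |H K| / (-e)) * (G * D ^ ℓ * B ^ κ) := by linarith
      _ ≤ (2 ^ ℓ * |H 0| / κ + ∑ k ∈ Finset.range K, 2 ^ (ℓ + k + 1) * |H k|
            + 2 ^ (ℓ + K) * |H K| / (-e)) * (G * D ^ ℓ * (2 ^ κ * (D / (|a| + D)) ^ κ)) := by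
          have : 0 < -e := by linarith
          gcongr
      _ = C2 * (G * D ^ ℓ * (D / (|a| + D)) ^ κ) := by rw [hC2]; ring
      _ ≤ _ := by
        have := mul_nonneg hC10 hscale
        linarith

end IsEndpointWeight

/-! ### Splitting the weight into its endpoint parts -/

/-- The functions `ψ_k` with `(d/ds)^k (s ^ (κ - 1) ψ s) = s ^ (κ - 1 - k) ψ_k s` for `s > 0`. -/
noncomputable def endpointFactor (κ : ℝ) (ψ : ℝ → ℝ) : ℕ → ℝ → ℝ
  | 0 => ψ
  | k + 1 => fun s => (κ - 1 - k) * endpointFactor κ ψ k s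
      + s * derivWithin (endpointFactor κ ψ k) (Set.Ici 0) s

section EndpointFactor

variable {κ : ℝ} {ψ : ℝ → ℝ}

lemma contDiffOn_endpointFactor (hψ : ContDiffOn ℝ ∞ ψ (Set.Ici 0)) (k : ℕ) :
    ContDiffOn ℝ ∞ (endpointFactor κ ψ k) (Set.Ici 0) := by
  induction k with
  | zero => exact hψ
  | succ k ih =>
    exact (contDiffOn_const.mul ih).add
      (contDiffOn_id.mul (ih.derivWithin (uniqueDiffOn_Ici 0) (by simp)))

lemma endpointFactor_eq_zero (hψ : ∀ s, 5 / 4 < s → ψ s = 0) (k : ℕ) :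
    ∀ s, 5 / 4 < s → endpointFactor κ ψ k s = 0 := by
  induction k with
  | zero => exact hψ
  | succ k ih =>
    intro s hs
    have h1 : endpointFactor κ ψ k =ᶠ[nhdsWithin s (Set.Ici 0)] fun _ => 0 :=
      (Filter.eventually_of_mem (Ioi_mem_nhds hs) fun t ht => ih t ht).filter_mono nhdsWithin_le_nhds
    change (κ - 1 - k) * endpointFactor κ ψ k s
      + s * derivWithin (endpointFactor κ ψ k) (Set.Ici 0) s = 0
    rw [ih s hs, h1.derivWithin_eq (ih s hs)]
    simp

lemma exists_isEndpointWeight (hψ : ContDiffOn ℝ ∞ ψ (Set.Ici 0))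
    (hψ0 : ∀ s, 5 / 4 < s → ψ s = 0) :
    ∃ (h : ℕ → ℝ → ℝ) (H : ℕ → ℝ), IsEndpointWeight κ h H ∧ ∀ s, h 0 s = s ^ (κ - 1) * ψ s := by
  have hbd : ∀ k : ℕ, ∃ C : ℝ, ∀ s ∈ Set.Icc (0 : ℝ) (5 / 4), ‖endpointFactor κ ψ k s‖ ≤ C :=
    fun k => isCompact_Icc.exists_bound_of_continuousOn
      ((contDiffOn_endpointFactor hψ k).continuousOn.mono Set.Icc_subset_Ici_self)
  choose H hH using hbd
  have hH0 : ∀ k, 0 ≤ H k := fun k => (norm_nonneg _).trans (hH k 0 ⟨le_rfl, by norm_num⟩)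
  refine ⟨fun k s => s ^ (κ - 1 - k) * endpointFactor κ ψ k s, H, ⟨?_, ?_, ?_, hH0⟩, fun s => by
    simp [endpointFactor]⟩
  · intro k s hs
    have h1 : HasDerivAt (endpointFactor κ ψ k)
        (derivWithin (endpointFactor κ ψ k) (Set.Ici 0) s) s :=
      (((contDiffOn_endpointFactor hψ k).differentiableOn (by simp)) s
        hs.le).hasDerivWithinAt.hasDerivAt (Ici_mem_nhds hs)
    have h2 := ((hasDerivAt_id s).rpow_const (p := κ - 1 - k) (Or.inl hs.ne')).mul h1
    refine h2.congr_deriv ?_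
    simp only [id, endpointFactor]
    have e : s ^ (κ - 1 - k) = s ^ (κ - 1 - ((k + 1 : ℕ) : ℝ)) * s := by
      rw [← Real.rpow_add_one hs.ne']; congr 1; push_cast; ring
    rw [e, show κ - 1 - (k : ℝ) - 1 = κ - 1 - ((k + 1 : ℕ) : ℝ) by push_cast; ring]
    ring
  · intro k s hs
    rw [abs_mul, abs_of_pos (Real.rpow_pos_of_pos hs _), mul_comm]
    refine mul_le_mul_of_nonneg_right ?_ (by positivity)
    rcases le_or_gt s (5 / 4) with h | h
    · exact hH k s ⟨hs.le, h⟩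
    · rw [endpointFactor_eq_zero hψ0 k s h, abs_zero]; exact hH0 k
  · intro k s hs
    rw [endpointFactor_eq_zero hψ0 k s hs, mul_zero]

end EndpointFactor

/-- The smooth part, near the endpoint `t = 1`, of the weight `φ t (1 - t ^ 2) ^ (κ - 1)` in the
variable `s = 1 - t`, cut off away from `s = 2`. -/
noncomputable def localFactor (κ : ℝ) (φ : ℝ → ℝ) (s : ℝ) : ℝ :=
  φ (1 - s) * (2 - s) ^ (κ - 1) * Real.smoothTransition (5 / 2 - 2 * s)

lemma localFactor_eq_zero (κ : ℝ) (φ : ℝ → ℝ) (s : ℝ) (hs : 5 / 4 < s) :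
    localFactor κ φ s = 0 := by
  rw [localFactor, Real.smoothTransition.zero_of_nonpos (by linarith), mul_zero]

lemma contDiffOn_localFactor (κ : ℝ) {φ : ℝ → ℝ} (hφ : ContDiffOn ℝ ∞ φ (Set.Icc (-1) 1)) :
    ContDiffOn ℝ ∞ (localFactor κ φ) (Set.Ici 0) := by
  have h1 : ContDiffOn ℝ ∞ (localFactor κ φ) (Set.Ico 0 2) := by
    refine ((hφ.comp (by fun_prop) ?_).mul ?_).mul ?_
    · intro s hs; exact ⟨by linarith [hs.2], by linarith [hs.1]⟩
    · refine ContDiffOn.rpow_const_of_ne (by fun_prop) fun s hs => ?_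
      linarith [hs.2]
    · exact (Real.smoothTransition.contDiff.comp (by fun_prop)).contDiffOn
  intro s hs
  rcases lt_or_ge s 2 with h | h
  · refine (h1 s ⟨hs, h⟩).mono_of_mem_nhdsWithin ?_
    rw [← Set.Ici_inter_Iio]
    exact Filter.inter_mem self_mem_nhdsWithin (mem_nhdsWithin_of_mem_nhds (Iio_mem_nhds h))
  · have h2 : localFactor κ φ =ᶠ[nhds s] fun _ => 0 :=
      Filter.eventually_of_mem (Ioi_mem_nhds (by linarith : (5 / 4 : ℝ) < s))
        fun t ht => localFactor_eq_zero κ φ t ht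
    exact (contDiffAt_const.congr_of_eventuallyEq h2).contDiffWithinAt

lemma smoothTransition_add_one_sub (x : ℝ) :
    Real.smoothTransition x + Real.smoothTransition (1 - x) = 1 := by
  have h := (Real.smoothTransition.pos_denom x).ne'
  rw [Real.smoothTransition, Real.smoothTransition, sub_sub_cancel,
    add_comm (expNegInvGlue (1 - x)), ← add_div, div_self h]

/-- A partition of unity splits the weight into its two endpoint parts. -/
lemma weight_eq_add {κ : ℝ} (φ : ℝ → ℝ) {t : ℝ} (h1 : -1 < t) (h2 : t < 1) :
    φ t * (1 - t ^ 2) ^ (κ - 1)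
      = (1 - t) ^ (κ - 1) * localFactor κ φ (1 - t)
        + (1 + t) ^ (κ - 1) * localFactor κ (fun t => φ (-t)) (1 + t) := by
  have hst := smoothTransition_add_one_sub (1 / 2 + 2 * t)
  have e0 : (1 - t ^ 2) ^ (κ - 1) = (1 - t) ^ (κ - 1) * (1 + t) ^ (κ - 1) := by
    rw [← Real.mul_rpow (by linarith) (by linarith)]; congr 1; ring
  simp only [localFactor]
  rw [e0, show 1 - (1 - t) = t by ring, show -(1 - (1 + t)) = t by ring,
    show 2 - (1 - t) = 1 + t by ring, show 2 - (1 + t) = 1 - t by ring,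
    show 5 / 2 - 2 * (1 - t) = 1 / 2 + 2 * t by ring,
    show 5 / 2 - 2 * (1 + t) = 1 - (1 / 2 + 2 * t) by ring]
  linear_combination (-(φ t * (1 - t) ^ (κ - 1) * (1 + t) ^ (κ - 1))) * hst

lemma intervalIntegral_weight {κ : ℝ} (hκ : 0 < κ) {φ : ℝ → ℝ} {h₁ h₂ : ℕ → ℝ → ℝ} {H₁ H₂ : ℕ → ℝ}
    (hh₁ : IsEndpointWeight κ h₁ H₁) (hh₂ : IsEndpointWeight κ h₂ H₂)
    (e₁ : ∀ s, h₁ 0 s = s ^ (κ - 1) * localFactor κ φ s)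
    (e₂ : ∀ s, h₂ 0 s = s ^ (κ - 1) * localFactor κ (fun t => φ (-t)) s)
    {F : ℝ → ℝ} (hF : Continuous F) :
    MeasureTheory.IntegrableOn (fun t => F t * (φ t * (1 - t ^ 2) ^ (κ - 1))) (Set.Icc (-1) 1) ∧
    ∫ t in Set.Icc (-1 : ℝ) 1, F t * (φ t * (1 - t ^ 2) ^ (κ - 1))
      = (∫ s in (0 : ℝ)..2, F (1 - s) * h₁ 0 s) + ∫ s in (0 : ℝ)..2, F (s - 1) * h₂ 0 s := by
  have i₁ : IntervalIntegrable (fun t => F t * h₁ 0 (1 - t)) MeasureTheory.volume (-1) 1 := by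
    have := ((hh₁.intervalIntegrable hκ (a := 2) (b := 0) (by norm_num) le_rfl).comp_sub_left 1)
    norm_num at this
    exact this.continuousOn_mul hF.continuousOn
  have i₂ : IntervalIntegrable (fun t => F t * h₂ 0 (t + 1)) MeasureTheory.volume (-1) 1 := by
    have := ((hh₂.intervalIntegrable hκ (a := 0) (b := 2) le_rfl (by norm_num)).comp_add_right 1)
    norm_num at this
    exact this.continuousOn_mul hF.continuousOn
  have hEq : Set.EqOn (fun t => F t * h₁ 0 (1 - t) + F t * h₂ 0 (t + 1))
      (fun t => F t * (φ t * (1 - t ^ 2) ^ (κ - 1))) (Set.Ioo (-1) 1) := by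
    intro t ht
    simp only [e₁, e₂]
    rw [weight_eq_add φ ht.1 ht.2, add_comm t 1]
    ring
  constructor
  · rw [integrableOn_Icc_iff_integrableOn_Ioo]
    refine MeasureTheory.IntegrableOn.congr_fun ?_ hEq measurableSet_Ioo
    have := i₁.add i₂
    rw [intervalIntegrable_iff_integrableOn_Ioo_of_le (by norm_num)] at this
    exact this
  · rw [MeasureTheory.integral_Icc_eq_integral_Ioo,
      ← MeasureTheory.setIntegral_congr_fun measurableSet_Ioo hEq,
      ← MeasureTheory.integral_Ioc_eq_integral_Ioo,
      ← intervalIntegral.integral_of_le (by norm_num), intervalIntegral.integral_add i₁ i₂]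
    congr 1
    · have := intervalIntegral.integral_comp_sub_left (a := -1) (b := 1)
        (fun s => F (1 - s) * h₁ 0 s) 1
      norm_num at this
      exact this
    · have := intervalIntegral.integral_comp_add_right (a := -1) (b := 1)
        (fun s => F (s - 1) * h₂ 0 s) 1
      norm_num at this
      exact this

section Convolution

variable {f w : ℝ → ℝ}

lemma exists_bound_comp_sub_mul (hf : Continuous f) (a y₀ : ℝ) :
    ∃ M : ℝ, ∀ y ∈ Metric.ball y₀ 1, ∀ s ∈ Set.uIoc (0 : ℝ) 2, |f (y - a * s)| ≤ M := by
  obtain ⟨M, hM⟩ := ((isCompact_closedBall y₀ 1).prod (isCompact_Icc (a := (0 : ℝ)) (b := 2))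
    ).exists_bound_of_continuousOn (f := fun p : ℝ × ℝ => f (p.1 - a * p.2)) (by fun_prop)
  refine ⟨M, fun y hy s hs => hM (y, s) ⟨Metric.ball_subset_closedBall hy, ?_⟩⟩
  rw [Set.uIoc_of_le (by norm_num)] at hs
  exact ⟨hs.1.le, hs.2⟩

lemma continuous_integral_comp_sub_mul (hf : Continuous f)
    (hw : IntervalIntegrable w MeasureTheory.volume 0 2) (a : ℝ) :
    Continuous fun y => ∫ s in (0 : ℝ)..2, f (y - a * s) * w s := by
  rw [continuous_iff_continuousAt]
  intro y₀
  obtain ⟨M, hM⟩ := exists_bound_comp_sub_mul hf a y₀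
  refine intervalIntegral.continuousAt_of_dominated_interval (bound := fun s => M * |w s|)
    (Filter.Eventually.of_forall fun y => ?_) ?_ (hw.norm.const_mul M)
    (Filter.Eventually.of_forall fun s _ => ?_)
  · exact (hw.continuousOn_mul (f := fun s => w s) (g := fun s => f (y - a * s))
      (by fun_prop)).def'.aestronglyMeasurable
  · filter_upwards [Metric.ball_mem_nhds y₀ one_pos] with y hy
    refine Filter.Eventually.of_forall fun s hs => ?_
    rw [norm_mul]
    exact mul_le_mul_of_nonneg_right (hM y hy s hs) (norm_nonneg _)
  · fun_prop

lemma hasDerivAt_integral_comp_sub_mul {g : ℝ → ℝ} (hf : Continuous f) (hg : ∀ z, HasDerivAt g (f z) z)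
    (hw : IntervalIntegrable w MeasureTheory.volume 0 2) (a y : ℝ) :
    HasDerivAt (fun y => ∫ s in (0 : ℝ)..2, g (y - a * s) * w s)
      (∫ s in (0 : ℝ)..2, f (y - a * s) * w s) y := by
  have hgc : Continuous g := continuous_iff_continuousAt.2 fun z => (hg z).continuousAt
  obtain ⟨M, hM⟩ := exists_bound_comp_sub_mul hf a y
  have hint : ∀ {u : ℝ → ℝ}, Continuous u → ∀ y, IntervalIntegrable (fun s => u (y - a * s) * w s)
      MeasureTheory.volume 0 2 := fun {u} hu y =>
    hw.continuousOn_mul (g := fun s => u (y - a * s)) (by fun_prop)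
  refine (intervalIntegral.hasDerivAt_integral_of_dominated_loc_of_deriv_le
    (F := fun y s => g (y - a * s) * w s) (F' := fun y s => f (y - a * s) * w s)
    (bound := fun s => M * |w s|) (Metric.ball_mem_nhds y one_pos)
    (Filter.Eventually.of_forall fun y => (hint hgc y).def'.aestronglyMeasurable) (hint hgc y)
    (hint hf y).def'.aestronglyMeasurable (Filter.Eventually.of_forall fun s hs z hz => ?_)
    (hw.norm.const_mul M) (Filter.Eventually.of_forall fun s hs z hz => ?_)).2
  · rw [norm_mul]
    exact mul_le_mul_of_nonneg_right (hM z hz s hs) (norm_nonneg _)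
  · exact ((hg (z - a * s)).comp_sub_const z (a * s)).mul_const (w s)

end Convolution

/-! ### Averaging a chain in one variable -/

lemma sqrt_add_le_add {x y : ℝ} (hx : 0 ≤ x) (hy : 0 ≤ y) : √(x + y) ≤ √x + √y := by
  refine Real.sqrt_le_iff.2 ⟨by positivity, ?_⟩
  have h := mul_nonneg (Real.sqrt_nonneg x) (Real.sqrt_nonneg y)
  nlinarith [Real.sq_sqrt hx, Real.sq_sqrt hy]

/-- Since `1 - |·|` is concave, the scale cannot collapse on the first `5 / 8` of a segment. -/
lemma half_oscScale_le {ε y a s : ℝ} (hε : 0 < ε) (hy : |y| ≤ 1) (hya : |y - 2 * a| ≤ 1)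
    (hs0 : 0 ≤ s) (hs1 : s ≤ 5 / 4) : oscScale ε y / 2 ≤ oscScale ε (y - a * s) := by
  have h1 : |y - a * s| ≤ (1 - s / 2) * |y| + s / 2 := by
    calc |y - a * s| = |(1 - s / 2) * y + s / 2 * (y - 2 * a)| := by congr 1; ring
      _ ≤ |(1 - s / 2) * y| + |s / 2 * (y - 2 * a)| := abs_add_le _ _
      _ = (1 - s / 2) * |y| + s / 2 * |y - 2 * a| := by
        rw [abs_mul, abs_mul, abs_of_nonneg (by linarith : 0 ≤ 1 - s / 2),
          abs_of_nonneg (by linarith : 0 ≤ s / 2)]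
      _ ≤ _ := by nlinarith
  have h2 : √(1 - |y|) / 2 ≤ √(1 - |y - a * s|) := by
    refine Real.le_sqrt_of_sq_le ?_
    rw [div_pow, Real.sq_sqrt (by linarith)]
    nlinarith
  rw [oscScale, oscScale]
  nlinarith [sq_nonneg ε]

lemma oscScale_sub_mul_le {ε y a s : ℝ} (hε : 0 < ε) (hy : |y| ≤ 1) (hs0 : 0 ≤ s) :
    oscScale ε (y - a * s) ≤ oscScale ε y + √(oscScale ε y * (|a| * s)) := by
  have has : 0 ≤ |a| * s := by positivity
  have h1 : 1 - |y - a * s| ≤ (1 - |y|) + |a| * s := by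
    have := abs_sub_abs_le_abs_sub y (a * s)
    rw [abs_mul, abs_of_nonneg hs0] at this
    linarith
  have h2 := (Real.sqrt_le_sqrt h1).trans (sqrt_add_le_add (by linarith) has)
  have h3 : ε ≤ √(oscScale ε y) := Real.le_sqrt_of_sq_le (by
    rw [oscScale]; have := Real.sqrt_nonneg (1 - |y|); nlinarith)
  rw [Real.sqrt_mul (oscScale_pos hε y).le]
  have h4 := mul_le_mul_of_nonneg_right h3 (Real.sqrt_nonneg (|a| * s))
  calc oscScale ε (y - a * s) ≤ ε * (√(1 - |y|) + √(|a| * s)) + ε ^ 2 := by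
        rw [oscScale]; gcongr
    _ ≤ _ := by rw [oscScale] at h4 ⊢; linarith

/-- A nonnegative function of the scale which decays at least like `u ^ (-τ)` and at most like
`u ^ (-σ)`. -/
structure IsScaleProfile (σ τ : ℝ) (g : ℝ → ℝ) : Prop where
  nonneg : ∀ u, 0 < u → 0 ≤ g u
  antitoneOn : AntitoneOn (fun u => g u * u ^ τ) (Set.Ioi 0)
  monotoneOn : MonotoneOn (fun u => g u * u ^ σ) (Set.Ioi 0)

namespace IsScaleProfile

variable {σ τ : ℝ} {g : ℝ → ℝ}

lemma le_of_le (hg : IsScaleProfile σ τ g) (hτ : 0 ≤ τ) {u v : ℝ} (hu : 0 < u) (huv : u ≤ v) :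
    g v ≤ g u := by
  have hv : 0 < v := hu.trans_le huv
  have h1 : g v * v ^ τ ≤ g u * u ^ τ := hg.antitoneOn hu hv huv
  have h2 : u ^ τ ≤ v ^ τ := Real.rpow_le_rpow hu.le huv hτ
  have h3 : g v * v ^ τ ≤ g u * v ^ τ := h1.trans (mul_le_mul_of_nonneg_left h2 (hg.nonneg u hu))
  exact le_of_mul_le_mul_right h3 (by positivity)

lemma le_two_rpow_mul (hg : IsScaleProfile σ τ g) (hτ : 0 ≤ τ) {u v : ℝ} (hu : 0 < u)
    (huv : u / 2 ≤ v) : g v ≤ 2 ^ σ * g u := by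
  have h1 : g (u / 2) * (u / 2) ^ σ ≤ g u * u ^ σ :=
    hg.monotoneOn (by simpa using hu) hu (by linarith)
  have h2 : u ^ σ = 2 ^ σ * (u / 2) ^ σ := by
    rw [← Real.mul_rpow (by norm_num) (by positivity)]; congr 1; ring
  rw [h2] at h1
  refine (hg.le_of_le hτ (by positivity) huv).trans ?_
  refine le_of_mul_le_mul_right (?_ : _ ≤ _ * (u / 2) ^ σ) (by positivity)
  linarith

lemma mul_rpow (hg : IsScaleProfile σ τ g) {κ b : ℝ} (hκ : 0 ≤ κ) (hb : 0 ≤ b) :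
    IsScaleProfile σ (τ - κ) fun u => g u * (u / (b + u)) ^ κ where
  nonneg u hu := by have := hg.nonneg u hu; positivity
  antitoneOn := by
    intro u hu v hv huv
    have hu : 0 < u := hu
    have hv : 0 < v := hv
    have key : ∀ w : ℝ, 0 < w →
        g w * (w / (b + w)) ^ κ * w ^ (τ - κ) = g w * w ^ τ * ((b + w)⁻¹) ^ κ := by
      intro w hw
      rw [div_eq_mul_inv, Real.mul_rpow hw.le (by positivity), Real.rpow_sub hw]
      field_simp
    simp only
    rw [key u hu, key v hv]
    have := hg.nonneg u hu
    exact mul_le_mul (hg.antitoneOn hu hv huv) (Real.rpow_le_rpow (by positivity) (by gcongr) hκ)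
      (by positivity) (by positivity)
  monotoneOn := by
    intro u hu v hv huv
    have hu : 0 < u := hu
    have hv : 0 < v := hv
    have h1 : (u / (b + u)) ^ κ ≤ (v / (b + v)) ^ κ := by
      refine Real.rpow_le_rpow (by positivity) ?_ hκ
      rw [div_le_div_iff₀ (by positivity) (by positivity)]
      nlinarith
    have h2 : g u * u ^ σ ≤ g v * v ^ σ := hg.monotoneOn hu hv huv
    have := hg.nonneg v hv
    have := hg.nonneg u hu
    calc g u * (u / (b + u)) ^ κ * u ^ σ = (g u * u ^ σ) * (u / (b + u)) ^ κ := by ring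
      _ ≤ (g v * v ^ σ) * (v / (b + v)) ^ κ := by gcongr
      _ = _ := by ring

end IsScaleProfile

/-- Averaging a chain against an endpoint weight gives a chain, with the profile multiplied by
`(u / (|a| + u)) ^ κ`. -/
lemma exists_average_chain {κ σ : ℝ} (hκ : 0 < κ) {h : ℕ → ℝ → ℝ} {H : ℕ → ℝ}
    (hh : IsEndpointWeight κ h H) {L K : ℕ} (hK : L + 2 * κ < K) {A : ℝ} (hA : 0 ≤ A) :
    ∃ A' : ℝ, 0 ≤ A' ∧ ∀ (ε a τ : ℝ) (S : Set ℝ) (f : ℕ → ℝ → ℝ) (g : ℝ → ℝ), 0 < ε → a ≠ 0 →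
      0 ≤ τ → S ⊆ Set.Icc (-1) 1 → Convex ℝ S → IsScaleProfile σ τ g →
      IsPrimitiveChain (L + K) f →
      (∀ ℓ ≤ L + K, ∀ z ∈ S, |f ℓ z| ≤ A * (g (oscScale ε z) * oscScale ε z ^ ℓ)) →
      IsPrimitiveChain L (fun ℓ y => ∫ s in (0 : ℝ)..2, f ℓ (y - a * s) * h 0 s) ∧
      ∀ ℓ ≤ L, ∀ y ∈ S, y - 2 * a ∈ S →
        |∫ s in (0 : ℝ)..2, f ℓ (y - a * s) * h 0 s| ≤ A' * (g (oscScale ε y)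
          * (oscScale ε y / (|a| + oscScale ε y)) ^ κ * oscScale ε y ^ ℓ) := by
  have hex : ∀ ℓ : ℕ, ∃ C : ℝ, 0 ≤ C ∧ (ℓ ≤ L → ∀ h : ℕ → ℝ → ℝ, IsEndpointWeight κ h H →
      ∀ (a D G : ℝ) (F : ℕ → ℝ → ℝ), a ≠ 0 → 0 < D → 0 ≤ G → (∀ i, Continuous (F i)) →
      (∀ i < ℓ + K, ∀ s, HasDerivAt (F (i + 1)) (-a * F i s) s) →
      (∀ i ≤ ℓ + K, ∀ s, 0 < s → s ≤ 5 / 4 → |F i s| ≤ G * (D + √(D * (|a| * s))) ^ i) →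
      |∫ s in (0 : ℝ)..2, F ℓ s * h 0 s| ≤ C * (G * D ^ ℓ * (D / (|a| + D)) ^ κ)) := by
    intro ℓ
    by_cases hℓ : ℓ ≤ L
    · have hℓ' : (ℓ : ℝ) ≤ L := by exact_mod_cast hℓ
      obtain ⟨C, hC, h1⟩ := IsEndpointWeight.exists_abs_integral_le hκ H ℓ K (by linarith)
      exact ⟨C, hC, fun _ => h1⟩
    · exact ⟨0, le_rfl, fun h => absurd h hℓ⟩
  choose C hC hmain using hex
  have hsum : 0 ≤ ∑ ℓ ∈ Finset.range (L + 1), C ℓ := Finset.sum_nonneg fun _ _ => hC _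
  refine ⟨(∑ ℓ ∈ Finset.range (L + 1), C ℓ) * (A * 2 ^ σ), by positivity, ?_⟩
  intro ε a τ S f g hε ha hτ hS hSc hg hf hfb
  have hw := hh.intervalIntegrable hκ (a := 0) (b := 2) le_rfl (by norm_num)
  refine ⟨⟨fun ℓ => continuous_integral_comp_sub_mul (hf.continuous ℓ) hw a, fun ℓ hℓ y =>
    hasDerivAt_integral_comp_sub_mul (hf.continuous ℓ) (hf.hasDerivAt ℓ (by omega)) hw a y⟩, ?_⟩
  intro ℓ hℓ y hy hya
  have hy1 : |y| ≤ 1 := abs_le.2 (hS hy)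
  have hya1 : |y - 2 * a| ≤ 1 := abs_le.2 (hS hya)
  set D := oscScale ε y with hD
  have hD0 : 0 < D := oscScale_pos hε y
  have hg0 := hg.nonneg D hD0
  have h1 := hmain ℓ hℓ h hh a D (A * (2 ^ σ * g D)) (fun i s => f i (y - a * s)) ha hD0
    (by positivity) (fun i => (hf.continuous i).comp (by fun_prop))
    (fun i hi s => by
      have h2 : HasDerivAt (fun s : ℝ => y - a * s) (-a) s := by
        simpa using ((hasDerivAt_id s).const_mul a).const_sub y
      exact ((hf.hasDerivAt i (by omega) (y - a * s)).comp s h2).congr_deriv (by ring))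
    (fun i hi s hs0 hs1 => by
      have hmem : y - a * s ∈ S := by
        have h3 := hSc hy hya (by linarith : 0 ≤ 1 - s / 2) (by linarith : 0 ≤ s / 2) (by ring)
        have e : (1 - s / 2) • y + (s / 2) • (y - 2 * a) = y - a * s := by
          simp only [smul_eq_mul]; ring
        rwa [e] at h3
      have hz0 := oscScale_pos hε (y - a * s)
      have h4 := hg.le_two_rpow_mul hτ hD0 (half_oscScale_le hε hy1 hya1 hs0.le hs1)
      have h5 := oscScale_sub_mul_le (a := a) hε hy1 hs0.le
      refine (hfb i (by omega) _ hmem).trans ?_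
      rw [mul_assoc A]
      gcongr)
  refine h1.trans ?_
  have h6 := Finset.single_le_sum (f := C) (fun i _ => hC i)
    (Finset.mem_range.2 (Nat.lt_succ_of_le hℓ))
  calc _ = C ℓ * (A * 2 ^ σ * (g D * (D / (|a| + D)) ^ κ * D ^ ℓ)) := by ring
    _ ≤ (∑ ℓ ∈ Finset.range (L + 1), C ℓ) * (A * 2 ^ σ * (g D * (D / (|a| + D)) ^ κ * D ^ ℓ)) := by
      gcongr
    _ = _ := by ring

/-! ### Several variables -/

open MeasureTheory in
lemma integrable_comp_sum_mul_prod {m : ℕ} {w : Fin m → ℝ → ℝ}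
    (hw : ∀ j, IntegrableOn (w j) (Set.Icc (-1) 1)) {f : ℝ → ℝ} (hf : Continuous f)
    (a : Fin m → ℝ) (x : ℝ) :
    Integrable (fun t : Fin m → ℝ => f (∑ j, a j * t j + x) * ∏ j, w j (t j))
      (Measure.pi fun _ => volume.restrict (Set.Icc (-1) 1)) := by
  have h1 : Integrable (fun t : Fin m → ℝ => ∏ j, w j (t j))
      (Measure.pi fun _ => volume.restrict (Set.Icc (-1) 1)) := Integrable.fintype_prod hw
  rw [← Measure.restrict_pi_pi] at h1 ⊢
  exact IntegrableOn.continuousOn_mul (by fun_prop) h1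
    (isCompact_univ_pi fun _ => isCompact_Icc)

open MeasureTheory in
/-- Integrating out the first variable of a product weight. -/
lemma integral_comp_sum_mul_prod_succ {m : ℕ} {w : Fin (m + 1) → ℝ → ℝ}
    (hw : ∀ j, IntegrableOn (w j) (Set.Icc (-1) 1)) {f : ℝ → ℝ} (hf : Continuous f)
    (a : Fin (m + 1) → ℝ) (x : ℝ) :
    ∫ t : Fin (m + 1) → ℝ, f (∑ j, a j * t j + x) * ∏ j, w j (t j)
        ∂(Measure.pi fun _ => volume.restrict (Set.Icc (-1) 1))
      = ∫ t : Fin m → ℝ, (∫ s in Set.Icc (-1 : ℝ) 1,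
          f (a 0 * s + (∑ j : Fin m, a j.succ * t j + x)) * w 0 s) * ∏ j : Fin m, w j.succ (t j)
        ∂(Measure.pi fun _ => volume.restrict (Set.Icc (-1) 1)) := by
  have hmp := (measurePreserving_piFinSuccAbove
    (fun _ : Fin (m + 1) => (volume : Measure ℝ).restrict (Set.Icc (-1) 1)) 0).symm
  rw [← hmp.integral_comp' (fun t : Fin (m + 1) → ℝ => f (∑ j, a j * t j + x) * ∏ j, w j (t j)),
    integral_prod_symm]
  · refine integral_congr_ae (Filter.Eventually.of_forall fun t => ?_)
    simp only [MeasurableEquiv.piFinSuccAbove_symm_apply, Fin.insertNthEquiv_apply,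
      Fin.insertNth_zero', Fin.sum_univ_succ, Fin.prod_univ_succ, Fin.cons_zero, Fin.cons_succ]
    rw [← integral_mul_const]
    refine integral_congr_ae (Filter.Eventually.of_forall fun s => ?_)
    simp only
    rw [add_assoc, mul_assoc]
  · have h1 := integrable_comp_sum_mul_prod hw hf a x
    exact (hmp.integrable_comp_emb (MeasurableEquiv.measurableEmbedding _)).2 h1

open MeasureTheory in
/-- The main estimate, by induction on the number of variables: the weight in each variable is split
into its two endpoint parts, and averaging the chain against either of them gives a chain of the same
kind, on the set of points from which the other endpoint can still be reached. -/
theorem exists_abs_integral_pi_le (σ : ℝ) (m : ℕ) : ∀ (κ : Fin m → ℝ) (φ : Fin m → ℝ → ℝ),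
    (∀ j, 0 < κ j) → (∀ j, ContDiffOn ℝ ∞ (φ j) (Set.Icc (-1) 1)) →
    (∀ j, IntegrableOn (fun t => φ j t * (1 - t ^ 2) ^ (κ j - 1)) (Set.Icc (-1) 1)) ∧
    ∃ L : ℕ, ∀ A : ℝ, 0 ≤ A → ∃ C : ℝ, 0 ≤ C ∧ ∀ (ε D x : ℝ) (a : Fin m → ℝ) (S : Set ℝ)
      (f : ℕ → ℝ → ℝ) (g : ℝ → ℝ), 0 < ε → 0 < D → (∀ j, a j ≠ 0) → S ⊆ Set.Icc (-1) 1 →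
      Convex ℝ S → IsScaleProfile σ (∑ j, κ j) g → IsPrimitiveChain L f →
      (∀ ℓ ≤ L, ∀ z ∈ S, |f ℓ z| ≤ A * (g (oscScale ε z) * oscScale ε z ^ ℓ)) →
      (∀ y, |y - x| ≤ ∑ j, |a j| → y ∈ S ∧ D ≤ oscScale ε y) →
      |∫ t : Fin m → ℝ, f 0 (∑ j, a j * t j + x) * ∏ j, (φ j (t j) * (1 - t j ^ 2) ^ (κ j - 1))
          ∂(Measure.pi fun _ => volume.restrict (Set.Icc (-1) 1))|
        ≤ C * (g D * ∏ j, (D / (|a j| + D)) ^ κ j) := by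
  induction m with
  | zero =>
    intro κ φ _ _
    refine ⟨fun j => j.elim0, 0, fun A hA => ⟨A, hA, ?_⟩⟩
    intro ε D x a S f g hε hD _ _ _ hg _ hfb hx
    rw [Measure.pi_of_empty, integral_dirac]
    simp only [Finset.univ_eq_empty, Finset.sum_empty, Finset.prod_empty, zero_add, mul_one] at hx ⊢
    obtain ⟨hxS, hDx⟩ := hx x (by simp)
    refine (hfb 0 le_rfl x hxS).trans (mul_le_mul_of_nonneg_left ?_ hA)
    rw [pow_zero, mul_one]
    exact hg.le_of_le (by simp) hD hDx
  | succ m ih =>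
    intro κ φ hκ hφ
    obtain ⟨hint, L, ihL⟩ := ih (fun j => κ j.succ) (fun j => φ j.succ) (fun j => hκ _) fun j => hφ _
    have hφneg : ContDiffOn ℝ ∞ (fun t => φ 0 (-t)) (Set.Icc (-1) 1) :=
      (hφ 0).comp (by fun_prop) fun t ht => ⟨by linarith [ht.2], by linarith [ht.1]⟩
    obtain ⟨h₁, H₁, hh₁, e₁⟩ := exists_isEndpointWeight (κ := κ 0)
      (contDiffOn_localFactor (κ 0) (hφ 0)) (localFactor_eq_zero (κ 0) (φ 0))
    obtain ⟨h₂, H₂, hh₂, e₂⟩ := exists_isEndpointWeight (κ := κ 0)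
      (contDiffOn_localFactor (κ 0) hφneg) (localFactor_eq_zero (κ 0) fun t => φ 0 (-t))
    have hweight : ∀ {F : ℝ → ℝ}, Continuous F → _ := fun {F} hF =>
      intervalIntegral_weight (hκ 0) hh₁ hh₂ e₁ e₂ (F := F) hF
    have hint' : ∀ j, IntegrableOn (fun t => φ j t * (1 - t ^ 2) ^ (κ j - 1)) (Set.Icc (-1) 1) := by
      refine Fin.cases ?_ hint
      simpa using (hweight (F := fun _ => 1) continuous_const).1
    refine ⟨hint', ?_⟩
    -- the remaining variables need a chain of length `L`; the `K` extra members are consumed by the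
    -- integrations by parts in the first variable
    obtain ⟨K, hK⟩ := exists_nat_gt (L + 2 * κ 0)
    refine ⟨L + K, fun A hA => ?_⟩
    obtain ⟨A₁, hA₁, hstep₁⟩ := exists_average_chain (σ := σ) (hκ 0) hh₁ hK hA
    obtain ⟨A₂, hA₂, hstep₂⟩ := exists_average_chain (σ := σ) (hκ 0) hh₂ hK hA
    obtain ⟨C₁, hC₁, hb₁⟩ := ihL A₁ hA₁
    obtain ⟨C₂, hC₂, hb₂⟩ := ihL A₂ hA₂
    refine ⟨C₁ + C₂, by positivity, ?_⟩
    intro ε D x a S f g hε hD ha hS hSc hg hf hfb hx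
    have hτ : 0 ≤ ∑ j, κ j := Finset.sum_nonneg fun j _ => (hκ j).le
    obtain ⟨hf₁, hfb₁⟩ := hstep₁ ε (a 0) _ S f g hε (ha 0) hτ hS hSc hg hf hfb
    obtain ⟨hf₂, hfb₂⟩ := hstep₂ ε (-a 0) _ S f g hε (neg_ne_zero.2 (ha 0)) hτ hS hSc hg hf hfb
    rw [abs_neg] at hfb₂
    have hg' := hg.mul_rpow (hκ 0).le (abs_nonneg (a 0))
    have hsumκ : (∑ j, κ j) - κ 0 = ∑ j : Fin m, κ j.succ := by
      rw [Fin.sum_univ_succ, add_sub_cancel_left]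
    rw [hsumκ] at hg'
    set f₁ : ℕ → ℝ → ℝ := fun ℓ y => ∫ s in (0 : ℝ)..2, f ℓ (y - a 0 * s) * h₁ 0 s with hf₁def
    set f₂ : ℕ → ℝ → ℝ := fun ℓ y => ∫ s in (0 : ℝ)..2, f ℓ (y - -a 0 * s) * h₂ 0 s with hf₂def
    -- the domain for the averages: both endpoints of the segment lie in `S`
    have hconv : ∀ c : ℝ, Convex ℝ (S ∩ {y | y - c ∈ S}) := fun c => by
      refine hSc.inter ?_
      refine (convex_iff_forall_pos.2 fun y hy z hz p q hp hq hpq => ?_)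
      have h3 := hSc hy hz hp.le hq.le hpq
      have e : p • (y - c) + q • (z - c) = (p • y + q • z) - c := by
        simp only [smul_eq_mul]; linear_combination (-c) * hpq
      rwa [e] at h3
    have hball : ∀ b : ℝ, |b| = |a 0| → ∀ y, |y - (x + b)| ≤ ∑ j : Fin m, |a j.succ| →
        y ∈ S ∩ {y | y - 2 * b ∈ S} ∧ D ≤ oscScale ε y := by
      intro b hb y hy
      have h1 : |y - x| ≤ ∑ j, |a j| := by
        rw [Fin.sum_univ_succ, ← hb]
        have := abs_add_le (y - (x + b)) b
        rw [show y - (x + b) + b = y - x by ring] at this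
        linarith
      have h2 : |y - 2 * b - x| ≤ ∑ j, |a j| := by
        rw [Fin.sum_univ_succ, ← hb]
        have := abs_sub (y - (x + b)) b
        rw [show y - (x + b) - b = y - 2 * b - x by ring] at this
        linarith
      exact ⟨⟨(hx y h1).1, (hx _ h2).1⟩, (hx y h1).2⟩
    have r₁ := hb₁ ε D (x + a 0) (fun j => a j.succ) (S ∩ {y | y - 2 * a 0 ∈ S}) f₁ _ hε hD
      (fun j => ha _) (Set.inter_subset_left.trans hS) (hconv _) hg' hf₁
      (fun ℓ hℓ z hz => hfb₁ ℓ hℓ z hz.1 hz.2) (hball _ rfl)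
    have r₂ := hb₂ ε D (x + -a 0) (fun j => a j.succ) (S ∩ {y | y - 2 * -a 0 ∈ S}) f₂ _ hε hD
      (fun j => ha _) (Set.inter_subset_left.trans hS) (hconv _) hg' hf₂
      (fun ℓ hℓ z hz => hfb₂ ℓ hℓ z hz.1 hz.2) (hball _ (abs_neg _))
    rw [integral_comp_sum_mul_prod_succ (w := fun j t => φ j t * (1 - t ^ 2) ^ (κ j - 1)) hint'
      (hf.continuous 0)]
    have hinner : ∀ z : ℝ, ∫ s in Set.Icc (-1 : ℝ) 1,
        f 0 (a 0 * s + z) * (φ 0 s * (1 - s ^ 2) ^ (κ 0 - 1)) = f₁ 0 (z + a 0) + f₂ 0 (z + -a 0) := by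
      intro z
      have hc := hf.continuous 0
      rw [(hweight (F := fun s => f 0 (a 0 * s + z)) (by fun_prop)).2]
      simp only [hf₁def, hf₂def]
      congr 3
      · ext s; congr 2; ring
      · ext s; congr 2; ring
    have hsplit : ∀ t : Fin m → ℝ, (∫ s in Set.Icc (-1 : ℝ) 1,
          f 0 (a 0 * s + (∑ j : Fin m, a j.succ * t j + x)) * (φ 0 s * (1 - s ^ 2) ^ (κ 0 - 1)))
          * ∏ j : Fin m, (φ j.succ (t j) * (1 - t j ^ 2) ^ (κ j.succ - 1))
        = f₁ 0 (∑ j : Fin m, a j.succ * t j + (x + a 0))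
            * ∏ j : Fin m, (φ j.succ (t j) * (1 - t j ^ 2) ^ (κ j.succ - 1))
          + f₂ 0 (∑ j : Fin m, a j.succ * t j + (x + -a 0))
            * ∏ j : Fin m, (φ j.succ (t j) * (1 - t j ^ 2) ^ (κ j.succ - 1)) := by
      intro t
      rw [hinner, add_mul, add_assoc, add_assoc]
    rw [integral_congr_ae (Filter.Eventually.of_forall hsplit), integral_add
      (integrable_comp_sum_mul_prod (w := fun j t => φ j.succ t * (1 - t ^ 2) ^ (κ j.succ - 1)) hint
        (hf₁.continuous 0) _ _)
      (integrable_comp_sum_mul_prod (w := fun j t => φ j.succ t * (1 - t ^ 2) ^ (κ j.succ - 1)) hint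
        (hf₂.continuous 0) _ _)]
    refine (abs_add_le _ _).trans ((add_le_add r₁ r₂).trans (le_of_eq ?_))
    rw [Fin.prod_univ_succ]
    ring

/-- Rewriting the target bound in terms of `D = n⁻¹ √d + n⁻²`, where `1 + n √d = n² D`. -/
lemma bound_eq_profile_mul_prod {m : ℕ} (κ : Fin m → ℝ) (α : ℝ) (a : Fin m → ℝ) {n : ℕ} (hn : 1 ≤ n)
    (r : ℝ) (hr : 0 ≤ r) (C : ℝ) :
    C * ((n : ℝ) ^ (-α - 1) * ((n : ℝ)⁻¹ * r + (n : ℝ)⁻¹ ^ 2) ^ (-α - 1 / 2)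
      * ∏ j, (((n : ℝ)⁻¹ * r + (n : ℝ)⁻¹ ^ 2) / (|a j| + ((n : ℝ)⁻¹ * r + (n : ℝ)⁻¹ ^ 2))) ^ κ j)
    = C * (n : ℝ) ^ (α - 2 * ∑ j, κ j)
        * (∏ j, (|a j| + (n : ℝ)⁻¹ * r + ((n : ℝ) ^ 2)⁻¹) ^ (-κ j))
        / (1 + (n : ℝ) * r) ^ (α + 1 / 2 - ∑ j, κ j) := by
  have hn0 : (0 : ℝ) < n := by exact_mod_cast hn
  set D : ℝ := (n : ℝ)⁻¹ * r + (n : ℝ)⁻¹ ^ 2 with hD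
  have hD0 : 0 < D := by positivity
  have h1 : 1 + (n : ℝ) * r = (n : ℝ) ^ (2 : ℝ) * D := by
    rw [hD, Real.rpow_two]; field_simp; ring
  have h2 : ∀ j, (D / (|a j| + D)) ^ κ j = D ^ κ j *
      (|a j| + (n : ℝ)⁻¹ * r + ((n : ℝ) ^ 2)⁻¹) ^ (-κ j) := by
    intro j
    have e : |a j| + (n : ℝ)⁻¹ * r + ((n : ℝ) ^ 2)⁻¹ = |a j| + D := by rw [hD, inv_pow]; ring
    rw [e, Real.div_rpow hD0.le (by positivity), Real.rpow_neg (by positivity), div_eq_mul_inv]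
  simp only [h2, Finset.prod_mul_distrib]
  rw [← Real.rpow_sum_of_pos hD0, h1, Real.mul_rpow (by positivity) hD0.le,
    ← Real.rpow_mul hn0.le, div_eq_mul_inv (_ * _), mul_inv, ← Real.rpow_neg hn0.le, ← Real.rpow_neg hD0.le]
  set T := ∑ j, κ j
  have e1 : (n : ℝ) ^ (-α - 1) = (n : ℝ) ^ (α - 2 * T) * (n : ℝ) ^ (-(2 * (α + 1 / 2 - T))) := by
    rw [← Real.rpow_add hn0]; congr 1; ring
  have e2 : D ^ (-(α + 1 / 2 - T)) = D ^ (-α - 1 / 2) * D ^ T := by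
    rw [← Real.rpow_add hD0]; congr 1; ring
  rw [e1, e2]
  ring

theorem theorem3p1 (m : ℕ) (κ : Fin m → ℝ) (hκ : ∀ j, 0 < κ j)
    (φ : Fin m → ℝ → ℝ) (hφ : ∀ j, ContDiffOn ℝ ∞ (φ j) (Set.Icc (-1) 1))
    (α β : ℝ) (hαβ : β ≤ α) (hακ : (∑ j, κ j) - 1 / 2 ≤ α) :
    ∃ c : ℝ, 0 < c ∧
      ∀ (n : ℕ) (a : Fin m → ℝ) (x : ℝ), 1 ≤ n → (∀ j, a j ≠ 0) → ∑ j, |a j| ≤ 1 →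
        |x| + ∑ j, |a j| ≤ 1 →
        MeasureTheory.IntegrableOn (jacobiIntegrand n α β κ φ a x)
            (Set.univ.pi fun _ : Fin m => Set.Icc (-1 : ℝ) 1) ∧
          |∫ t in Set.univ.pi fun _ : Fin m => Set.Icc (-1 : ℝ) 1,
              jacobiIntegrand n α β κ φ a x t|
            ≤ c * (n : ℝ) ^ (α - 2 * ∑ j, κ j)
              * (∏ j, (|a j| + (n : ℝ)⁻¹ * √(1 - (∑ i, |a i|) - |x|) + ((n : ℝ) ^ 2)⁻¹) ^ (-κ j))
              / (1 + (n : ℝ) * √(1 - (∑ j, |a j|) - |x|)) ^ (α + 1 / 2 - ∑ j, κ j) := by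
  obtain ⟨hint, L, hL⟩ := exists_abs_integral_pi_le (α + 1 / 2) m κ φ hκ hφ
  obtain ⟨A, hA, hchain⟩ := exists_jacobi_chain hαβ L
  obtain ⟨C, hC, hmain⟩ := hL A hA
  refine ⟨C + 1, by positivity, fun n a x hn ha _ hax => ?_⟩
  have hn0 : (0 : ℝ) < n := by exact_mod_cast hn
  obtain ⟨f, hf0, hf, hfb⟩ := hchain n hn
  rw [MeasureTheory.volume_pi, MeasureTheory.IntegrableOn, MeasureTheory.Measure.restrict_pi_pi]
  have hJ : jacobiIntegrand n α β κ φ a x = fun t : Fin m → ℝ =>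
      f 0 (∑ j, a j * t j + x) * ∏ j, (φ j (t j) * (1 - t j ^ 2) ^ (κ j - 1)) := by
    ext t; rw [jacobiIntegrand, hf0]
  rw [hJ]
  refine ⟨integrable_comp_sum_mul_prod (w := fun j t => φ j t * (1 - t ^ 2) ^ (κ j - 1)) hint
    (hf.continuous 0) a x, ?_⟩
  set d := √(1 - (∑ j, |a j|) - |x|) with hd
  rw [← bound_eq_profile_mul_prod κ α a hn d (Real.sqrt_nonneg _)]
  set D : ℝ := (n : ℝ)⁻¹ * d + (n : ℝ)⁻¹ ^ 2 with hD
  have hd0 : 0 ≤ d := Real.sqrt_nonneg _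
  have hD0 : 0 < D := by positivity
  have hprof : IsScaleProfile (α + 1 / 2) (∑ j, κ j)
      fun u => (n : ℝ) ^ (-α - 1) * u ^ (-α - 1 / 2) := by
    refine ⟨fun u hu => by positivity, ?_, ?_⟩
    · intro u hu v hv huv
      have hu : 0 < u := hu
      have hv : 0 < v := hv
      simp only
      rw [mul_assoc, mul_assoc, ← Real.rpow_add hu, ← Real.rpow_add hv]
      exact mul_le_mul_of_nonneg_left
        (Real.rpow_le_rpow_of_nonpos hu huv (by linarith)) (by positivity)
    · intro u hu v hv huv
      have hu : 0 < u := hu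
      have hv : 0 < v := hv
      simp only
      rw [mul_assoc, mul_assoc, ← Real.rpow_add hu, ← Real.rpow_add hv,
        show -α - 1 / 2 + (α + 1 / 2) = 0 by ring, Real.rpow_zero, Real.rpow_zero]
  have hb := hmain (n : ℝ)⁻¹ D x a (Set.Icc (-1) 1) f _ (by positivity) hD0 ha subset_rfl
    (convex_Icc _ _) hprof hf (fun ℓ hℓ z hz => hfb ℓ hℓ z (abs_le.2 hz)) (by
      intro y hy
      have hy' : |y| ≤ |x| + ∑ j, |a j| := by
        have := abs_add_le (y - x) x
        rw [sub_add_cancel] at this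
        linarith
      refine ⟨abs_le.1 (hy'.trans hax), ?_⟩
      rw [hD, hd, oscScale]
      gcongr ?_ * √?_ + _
      linarith)
  refine hb.trans (mul_le_mul_of_nonneg_right (by linarith) ?_)
  positivity
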